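/- **Conventions.** Let $e_1,\dots,e_6$ be the standard basis of euclidean space $\mathbb{R}^6=(\mathbb{R}^6)^*$, let $\mathrm{J}e_{2i-1}=e_{2i}$, $\mathrm{J}e_{2i}=-e_{2i-1}$, and let $\Omega(x,y)=\langle \mathrm{J}x,y\rangle$. Let $\mathrm{J}$ act on forms by $(\mathrm{J}\omega)(x,y,\dots)=\omega(\mathrm{J}x,\mathrm{J}y,\dots)$, let $*$ be the Hodge operator for the orientation $e_1\wedge\dots\wedge e_6$, and put $\tau(\mathrm{T})=\sum_i (e_i\lrcorner\Omega)\wedge(e_i\lrcorner \mathrm{T})$ for 3-forms $\mathrm{T}$. Set $$\Lambda^3_2=\{\mathrm{T}:\tau^2(\mathrm{T})=-9\,\mathrm{T},\ \mathrm{J}(\mathrm{T})=*\mathrm{T}\},\qquad \Lambda^3_{12}=\{\mathrm{T}:\tau^2(\mathrm{T})=-\mathrm{T},\ \mathrm{J}(\mathrm{T})=*\mathrm{T}\}.$$ Identify $\mathfrak{so}(6)=\Lambda^2(\mathbb{R}^6)$ by $\omega(x,y)=\langle \omega x,y\rangle$; then $\mathfrak{u}(3)=\{\omega:\mathrm{J}\omega=\omega\}$,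 with orthogonal complement $\mathfrak{m}=\{\omega:\mathrm{J}\omega=-\omega\}$. Put $$\Theta(\mathrm{T})=\sum_{i} e_i\otimes \mathrm{pr}_{\mathfrak{m}}(e_i\lrcorner \mathrm{T})\in\mathbb{R}^6\otimes\mathfrak{m},\qquad \Phi:\mathbb{R}^6\otimes\mathfrak{m}\to\Lambda^3(\mathbb{R}^6),\ \ \Phi(x\otimes\omega)=x\wedge\omega,\qquad \mathcal{W}_2=\ker\Phi .$$ Let $(M^6,g,\mathrm{J})$ be an almost hermitian manifold with Kähler form $\Omega(v,w)=g(\mathrm{J}v,w)$ and Levi-Civita connection $\nabla$, and let $\delta=-\sum_i e_i\lrcorner\nabla_{e_i}$ be the codifferential. For a local orthonormal frame $e_1,\dots,e_6$ with $\mathrm{J}e_{2i-1}=e_{2i}$ (a local section of the $\mathrm{U}(3)$-reduction of the frame bundle), the intrinsic torsion $\Gamma$ is the $\mathfrak{m}$-part of the connection form: $$\Gamma=\sum_{k} e_k\otimes \mathrm{pr}_{\mathfrak{m}}\Big(\sum_{i<j} g(\nabla_{e_k}e_i,e_j)\,e_i\wedge e_j\Big)\in\mathbb{R}^6\otimes\mathfrak{m}.$$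 Use such frames to identify tangent vectors and forms on $M$ with vectors and forms on $\mathbb{R}^6$. **Theorem.** The differential $d\Omega$ and the codifferential $\delta\Omega$ do not depend on the $\mathcal{W}_2$-component of the intrinsic torsion: if the intrinsic torsions of two almost hermitian 6-manifolds at given points, with respect to adapted frames, differ by an element of $\mathcal{W}_2$, then $d\Omega$ and $\delta\Omega$ have the same components at these points in these frames. Moreover, if at a point $$\Gamma=\Gamma_2+\Gamma_6+\Gamma_{12}+\Gamma_{16},\quad \Gamma_2=\Theta(\mathrm{T}_2),\ \ \Gamma_6=\Theta(X\wedge\Omega),\ \ \Gamma_{12}=\Theta(\mathrm{T}_{12}),\ \ \Gamma_{16}\in\mathcal{W}_2,$$ with $\mathrm{T}_2\in\Lambda^3_2$, $X\in\mathbb{R}^6$ and $\mathrm{T}_{12}\in\Lambda^3_{12}$, then at this point $$\delta\Omega=-4X,\qquad d\Omega=-6*\mathrm{T}_2-2*(X\wedge\Omega)+2*\mathrm{T}_{12}.$$ -/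

import Mathlib

open Bundle
open scoped Manifold ContDiff

set_option linter.unusedSectionVars false

noncomputable section

namespace AlmostHermitian

section LeviCivita

variable {E : Type*} [NormedAddCommGroup E] [NormedSpace ℝ E] [FiniteDimensional ℝ E]
  {M : Type*} [TopologicalSpace M] [ChartedSpace E M] [IsManifold 𝓘(ℝ, E) ∞ M]
  [RiemannianBundle (fun x : M => TangentSpace 𝓘(ℝ, E) x)]

/-- The right-hand side of the Koszul formula: for the Levi-Civita connection `∇` this is
`⟨∇_X Y, Z⟩` at the point `x`. -/
def koszul (X Y Z : Π x : M, TangentSpace 𝓘(ℝ, E) x) (x : M) : ℝ :=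
  (1 / 2) *
    (d% (fun y => inner ℝ (Y y) (Z y)) x (X x)
      + d% (fun y => inner ℝ (Z y) (X y)) x (Y x)
      - d% (fun y => inner ℝ (X y) (Y y)) x (Z x)
      + inner ℝ (VectorField.mlieBracket 𝓘(ℝ, E) X Y x) (Z x)
      - inner ℝ (VectorField.mlieBracket 𝓘(ℝ, E) X Z x) (Y x)
      - inner ℝ (VectorField.mlieBracket 𝓘(ℝ, E) Y Z x) (X x))

variable [IsContMDiffRiemannianBundle 𝓘(ℝ, E) ∞ E (fun x : M => TangentSpace 𝓘(ℝ, E) x)]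

variable [CompleteSpace E]

theorem mdiffAt_inner {Y Z : Π x : M, TangentSpace 𝓘(ℝ, E) x} {x : M}
    (hY : MDiffAt (T% Y) x) (hZ : MDiffAt (T% Z) x) :
    MDiffAt (fun y => (inner ℝ (Y y) (Z y) : ℝ)) x :=
  MDifferentiableAt.inner_bundle (IB := 𝓘(ℝ, E)) (F := E)
    (E := fun x : M => TangentSpace 𝓘(ℝ, E) x) hY hZ

theorem koszul_tensorial_left {Y Z : Π x : M, TangentSpace 𝓘(ℝ, E) x} {x : M}
    (hY : MDiffAt (T% Y) x) (hZ : MDiffAt (T% Z) x) :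
    TensorialAt 𝓘(ℝ, E) E (fun X => koszul X Y Z x) x where
  smul {f X} hf hX := by
    have h1 := mvfderiv_fun_mul hf (mdiffAt_inner hZ hX)
    have h2 := mvfderiv_fun_mul hf (mdiffAt_inner hX hY)
    simp only [koszul, Pi.smul_apply', real_inner_smul_left, real_inner_smul_right, map_smul, h1, h2,
      VectorField.mlieBracket_smul_left hf hX, inner_add_left]
    simp [real_inner_comm]
    ring
  add {X X'} hX hX' := by
    have h1 := mvfderiv_fun_add (mdiffAt_inner hZ hX) (mdiffAt_inner hZ hX')
    have h2 := mvfderiv_fun_add (mdiffAt_inner hX hY) (mdiffAt_inner hX' hY)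
    simp only [koszul, Pi.add_apply, map_add, inner_add_left, inner_add_right, h1, h2,
      VectorField.mlieBracket_add_left hX hX']
    simp
    ring

theorem koszul_tensorial_right {X Y : Π x : M, TangentSpace 𝓘(ℝ, E) x} {x : M}
    (hX : MDiffAt (T% X) x) (hY : MDiffAt (T% Y) x) :
    TensorialAt 𝓘(ℝ, E) E (fun Z => koszul X Y Z x) x where
  smul {f Z} hf hZ := by
    have h1 := mvfderiv_fun_mul hf (mdiffAt_inner hY hZ)
    have h2 := mvfderiv_fun_mul hf (mdiffAt_inner hZ hX)
    simp only [koszul, Pi.smul_apply', real_inner_smul_left, real_inner_smul_right, map_smul, h1, h2,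
      VectorField.mlieBracket_smul_right hf hZ, inner_add_left]
    simp [real_inner_comm]
    ring
  add {Z Z'} hZ hZ' := by
    have h1 := mvfderiv_fun_add (mdiffAt_inner hY hZ) (mdiffAt_inner hY hZ')
    have h2 := mvfderiv_fun_add (mdiffAt_inner hZ hX) (mdiffAt_inner hZ' hX)
    simp only [koszul, Pi.add_apply, map_add, inner_add_left, inner_add_right, h1, h2,
      VectorField.mlieBracket_add_right hZ hZ']
    simp
    ring

open Classical in
/-- The Levi-Civita connection as a function: if `Y` is differentiable at `x`, then
`leviCivitaFun Y x v` is the vector representing `Z ↦ koszul X Y Z x`, where `X x = v`. -/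
def leviCivitaFun (Y : Π x : M, TangentSpace 𝓘(ℝ, E) x) (x : M) :
    TangentSpace 𝓘(ℝ, E) x →L[ℝ] TangentSpace 𝓘(ℝ, E) x :=
  if hY : MDiffAt (T% Y) x then
    haveI : FiniteDimensional ℝ (TangentSpace 𝓘(ℝ, E) x) := inferInstanceAs (FiniteDimensional ℝ E)
    haveI : CompleteSpace (TangentSpace 𝓘(ℝ, E) x) :=
      FiniteDimensional.complete ℝ (TangentSpace 𝓘(ℝ, E) x)
    LinearMap.toContinuousLinearMap
      { toFun := fun v => (InnerProductSpace.toDual ℝ (TangentSpace 𝓘(ℝ, E) x)).symm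
          (TensorialAt.mkHom₂ (I := 𝓘(ℝ, E)) (F := E) (F' := E) (fun X Z => koszul X Y Z x) x
            (fun _ hZ => koszul_tensorial_left hY hZ) (fun _ hX => koszul_tensorial_right hX hY) v)
        map_add' := fun v w => by rw [map_add, map_add]
        map_smul' := fun c v => by rw [map_smul, LinearIsometryEquiv.map_smulₛₗ]; rfl }
  else 0

theorem inner_leviCivitaFun {X Y Z : Π x : M, TangentSpace 𝓘(ℝ, E) x} {x : M}
    (hX : MDiffAt (T% X) x) (hY : MDiffAt (T% Y) x) (hZ : MDiffAt (T% Z) x) :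
    inner ℝ (leviCivitaFun Y x (X x)) (Z x) = koszul X Y Z x := by
  rw [leviCivitaFun, dif_pos hY]
  have : FiniteDimensional ℝ (TangentSpace 𝓘(ℝ, E) x) := inferInstanceAs (FiniteDimensional ℝ E)
  have : CompleteSpace (TangentSpace 𝓘(ℝ, E) x) :=
      FiniteDimensional.complete ℝ (TangentSpace 𝓘(ℝ, E) x)
  refine (InnerProductSpace.toDual_symm_apply (𝕜 := ℝ) (E := TangentSpace 𝓘(ℝ, E) x)).trans ?_
  exact TensorialAt.mkHom₂_apply (I := 𝓘(ℝ, E)) (F := E) (F' := E) 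
        (Φ := fun X Z => koszul X Y Z x) 
        (fun _ hZ => koszul_tensorial_left hY hZ) (fun _ hX => koszul_tensorial_right hX hY) hX hZ

theorem ext_inner_fields {x : M} {A B : TangentSpace 𝓘(ℝ, E) x →L[ℝ] TangentSpace 𝓘(ℝ, E) x}
    (h : ∀ X Z : Π x : M, TangentSpace 𝓘(ℝ, E) x, MDiffAt (T% X) x → MDiffAt (T% Z) x →
      (inner ℝ (A (X x)) (Z x) : ℝ) = inner ℝ (B (X x)) (Z x)) : A = B := by
  ext v
  refine ext_inner_right ℝ fun z => ?_
  simpa using h (FiberBundle.extend E v) (FiberBundle.extend E z)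
    (FiberBundle.mdifferentiableAt_extend ..) (FiberBundle.mdifferentiableAt_extend ..)

/-- The Levi-Civita connection of the Riemannian metric; `leviCivita Y x v` is `∇_v Y` at `x`. -/
def leviCivita : CovariantDerivative 𝓘(ℝ, E) E (fun x : M => TangentSpace 𝓘(ℝ, E) x) where
  toFun := leviCivitaFun
  isCovariantDerivativeOnUniv :=
    { add := by
        intro Y Y' x hY hY' _
        have hYY : MDiffAt (T% (Y + Y')) x := mdifferentiableAt_add_section hY hY'
        refine ext_inner_fields fun X Z hX hZ => ?_
        rw [_root_.add_apply, inner_add_left, inner_leviCivitaFun hX hYY hZ,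
          inner_leviCivitaFun hX hY hZ, inner_leviCivitaFun hX hY' hZ]
        have h1 := mvfderiv_fun_add (mdiffAt_inner hY hZ) (mdiffAt_inner hY' hZ)
        have h2 := mvfderiv_fun_add (mdiffAt_inner hX hY) (mdiffAt_inner hX hY')
        simp only [koszul, Pi.add_apply, map_add, inner_add_left, inner_add_right, h1, h2,
          VectorField.mlieBracket_add_right hY hY', VectorField.mlieBracket_add_left hY hY']
        simp
        ring
      leibniz := by
        intro Y f x hY hf _
        have hfY : MDiffAt (T% (f • Y)) x := MDifferentiableAt.smul_section hf hY
        refine ext_inner_fields fun X Z hX hZ => ?_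
        rw [inner_leviCivitaFun hX hfY hZ]
        simp only [_root_.add_apply, _root_.smul_apply, inner_add_left,
          real_inner_smul_left, inner_leviCivitaFun hX hY hZ, ContinuousLinearMap.smulRight_apply]
        have h1 := mvfderiv_fun_mul hf (mdiffAt_inner hY hZ)
        have h2 := mvfderiv_fun_mul hf (mdiffAt_inner hX hY)
        simp only [koszul, Pi.smul_apply', real_inner_smul_left, real_inner_smul_right, map_smul,
          h1, h2, VectorField.mlieBracket_smul_right hf hY, VectorField.mlieBracket_smul_left hf hY,
          inner_add_left]
        simp [real_inner_comm]
        ring }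

/-- The Levi-Civita connection is torsion-free. -/
theorem leviCivita_torsion :
    (leviCivita : CovariantDerivative 𝓘(ℝ, E) E (fun x : M => TangentSpace 𝓘(ℝ, E) x)).torsion
      = 0 := by
  rw [CovariantDerivative.torsion_eq_zero_iff]
  intro X Y x hX hY
  refine ext_inner_right ℝ fun z => ?_
  have hZ := FiberBundle.mdifferentiableAt_extend 𝓘(ℝ, E) E z
  have h1 := inner_leviCivitaFun hX hY hZ
  have h2 := inner_leviCivitaFun hY hX hZ
  simp only [FiberBundle.extend_apply_self] at h1 h2
  rw [inner_sub_left]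
  refine (congrArg₂ (· - ·) h1 h2).trans ?_
  simp only [koszul, VectorField.mlieBracket_swap_apply (V := Y) (W := X), inner_neg_left,
    FiberBundle.extend_apply_self, real_inner_comm]
  ring

/-- The Levi-Civita connection is metric. -/
theorem leviCivita_metric {x : M} {X Y Z : Π x : M, TangentSpace 𝓘(ℝ, E) x} 
    (hX : MDiffAt (T% X) x) (hY : MDiffAt (T% Y) x) (hZ : MDiffAt (T% Z) x) :
    d% (fun y => inner ℝ (Y y) (Z y)) x (X x) 
      = inner ℝ (leviCivita Y x (X x)) (Z x) + inner ℝ (Y x) (leviCivita Z x (X x)) := by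
  have h1 := inner_leviCivitaFun hX hY hZ
  have h2 := inner_leviCivitaFun hX hZ hY
  rw [real_inner_comm] at h2
  refine Eq.trans ?_ (congrArg₂ (· + ·) h1 h2).symm
  simp only [koszul, VectorField.mlieBracket_swap_apply (V := Z) (W := Y), inner_neg_left,
    real_inner_comm]
  ring

/-- The covariant derivative `(∇_v η)(w_1, …, w_k)` at `p` of a `k`-form with respect to the
Levi-Civita connection, computed with local extensions of the vectors `w_i`. -/
def covDerivForm {k : ℕ} (η : Π x : M, TangentSpace 𝓘(ℝ, E) x [⋀^Fin k]→L[ℝ] ℝ) (p : M)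
    (v : TangentSpace 𝓘(ℝ, E) p) (w : Fin k → TangentSpace 𝓘(ℝ, E) p) : ℝ :=
  d% (fun x => η x (fun i => FiberBundle.extend E (w i) x)) p v
    - ∑ i, η p (Function.update w i (leviCivita (FiberBundle.extend E (w i)) p v))

/-- The codifferential `δη = - ∑ e_a ⌟ ∇_{e_a} η`, with `e_a` an orthonormal basis of the tangent
space. -/
def codifferential {k : ℕ} (η : Π x : M, TangentSpace 𝓘(ℝ, E) x [⋀^Fin (k + 1)]→L[ℝ] ℝ) (p : M)
    (w : Fin k → TangentSpace 𝓘(ℝ, E) p) : ℝ :=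
  haveI : FiniteDimensional ℝ (TangentSpace 𝓘(ℝ, E) p) := inferInstanceAs (FiniteDimensional ℝ E);
  -∑ a, covDerivForm η p (stdOrthonormalBasis ℝ (TangentSpace 𝓘(ℝ, E) p) a)
    (Fin.cons (stdOrthonormalBasis ℝ (TangentSpace 𝓘(ℝ, E) p) a) w)

end LeviCivita

section ExteriorDerivative

variable {E : Type*} [NormedAddCommGroup E] [NormedSpace ℝ E]
  {M : Type*} [TopologicalSpace M] [ChartedSpace E M]

/-- The exterior derivative of a differential form on a manifold: the exterior derivative, in the
chart at `p`, of the coordinate expression of the form, pulled back to the tangent space at `p`. -/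
def exteriorDerivative {k : ℕ} (η : Π x : M, TangentSpace 𝓘(ℝ, E) x [⋀^Fin k]→L[ℝ] ℝ) (p : M) :
    TangentSpace 𝓘(ℝ, E) p [⋀^Fin (k + 1)]→L[ℝ] ℝ :=
  (extDeriv
    (fun y : E => (η ((extChartAt 𝓘(ℝ, E) p).symm y)).compContinuousLinearMap
      (mfderiv 𝓘(ℝ, E) 𝓘(ℝ, E) (extChartAt 𝓘(ℝ, E) p).symm y :
        E →L[ℝ] TangentSpace 𝓘(ℝ, E) ((extChartAt 𝓘(ℝ, E) p).symm y)))
    (extChartAt 𝓘(ℝ, E) p p)).compContinuousLinearMap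
    (mfderiv 𝓘(ℝ, E) 𝓘(ℝ, E) (extChartAt 𝓘(ℝ, E) p) p : TangentSpace 𝓘(ℝ, E) p →L[ℝ] E)

end ExteriorDerivative

section Algebra

/-- Euclidean space of dimension six. -/
abbrev R6 : Type := EuclideanSpace ℝ (Fin 6)

/-- The `k`-forms on euclidean 6-space. -/
abbrev Form (k : ℕ) : Type := R6 [⋀^Fin k]→ₗ[ℝ] ℝ

/-- The standard basis; the indices `0, …, 5` stand for `1, …, 6`. -/
def stdVec (i : Fin 6) : R6 := EuclideanSpace.single i 1

/-- The standard complex structure `J e_{2i-1} = e_{2i}`, `J e_{2i} = - e_{2i-1}`. -/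
def stdJ : R6 →ₗ[ℝ] R6 where
  toFun v := !₂[-v 1, v 0, -v 3, v 2, -v 5, v 4]
  map_add' v w := by
    ext i
    fin_cases i <;> simp <;> ring
  map_smul' c v := by
    ext i
    fin_cases i <;> simp

theorem inner_stdJ_self (v : R6) : inner ℝ (stdJ v) v = 0 := by
  simp [stdJ, PiLp.inner_apply, Fin.sum_univ_succ]
  ring

/-- The 1-form `⟨x, ·⟩` identified with the vector `x`. -/
def flat (x : R6) : Form 1 := AlternatingMap.ofSubsingleton ℝ R6 ℝ (0 : Fin 1) (innerₗ R6 x)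

/-- The interior product `x ⌟ η`. -/
def contract {k : ℕ} (x : R6) (η : Form (k + 1)) : Form k := η.curryLeft x

/-- The exterior product `α ∧ η` of a 1-form and a `k`-form. -/
def wedge {k : ℕ} (α : Form 1) (η : Form k) : Form (k + 1) :=
  AlternatingMap.alternatizeUncurryFin
    (((AlternatingMap.ofSubsingleton ℝ R6 ℝ (0 : Fin 1)).symm α).smulRight η)

theorem wedge_apply (x : R6) (α : Form 2) (v : Fin 3 → R6) :
    wedge (flat x) α v = inner ℝ x (v 0) * α ![v 1, v 2] - inner ℝ x (v 1) * α ![v 0, v 2]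
      + inner ℝ x (v 2) * α ![v 0, v 1] := by
  have h0 : (Fin.removeNth 0 v : Fin 2 → R6) = ![v 1, v 2] := by
    ext i; fin_cases i <;> rfl
  have h1 : (Fin.removeNth 1 v : Fin 2 → R6) = ![v 0, v 2] := by
    ext i; fin_cases i <;> rfl
  have h2 : (Fin.removeNth 2 v : Fin 2 → R6) = ![v 0, v 1] := by
    ext i; fin_cases i <;> rfl
  simp [wedge, flat, AlternatingMap.alternatizeUncurryFin_apply, Fin.sum_univ_three, h0, h1, h2]
  ring

/-- The standard Kähler form `Ω(x, y) = ⟨J x, y⟩`. -/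
def stdOmega : Form 2 where
  toFun v := inner ℝ (stdJ (v 0)) (v 1)
  map_update_add' v i x y := by
    fin_cases i <;> simp [inner_add_left, inner_add_right]
  map_update_smul' v i c x := by
    fin_cases i <;> simp [real_inner_smul_left, real_inner_smul_right]
  map_eq_zero_of_eq' v i j h hij := by
    have : v 0 = v 1 := by
      fin_cases i <;> fin_cases j <;> simp_all
    rw [this]
    exact inner_stdJ_self _

/-- The action of the complex structure on forms, `(J η)(x, y, …) = η(J x, J y, …)`. -/
def actJ {k : ℕ} (η : Form k) : Form k := η.compLinearMap stdJ

/-- The volume form `e_1 ∧ … ∧ e_6`. -/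
def vol : Form 6 := (EuclideanSpace.basisFun (Fin 6) ℝ).toBasis.det

/-- The Hodge operator on 3-forms. -/
def hodge (T : Form 3) : Form 3 :=
  (1 / 6 : ℝ) • ∑ i, ∑ j, ∑ k, T ![stdVec i, stdVec j, stdVec k] •
    contract (stdVec k) (contract (stdVec j) (contract (stdVec i) vol))

/-- The action `τ` of the central element `Ω` of `u(3)` on 3-forms,
`τ(T) = ∑ (e_i ⌟ Ω) ∧ (e_i ⌟ T)`. -/
def tau (T : Form 3) : Form 3 :=
  ∑ i, wedge (contract (stdVec i) stdOmega) (contract (stdVec i) T)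

/-- The 2-dimensional component of the space of 3-forms. -/
def Lambda32 : Set (Form 3) := {T | tau (tau T) = (-9 : ℝ) • T ∧ actJ T = hodge T}

/-- The 12-dimensional component of the space of 3-forms. -/
def Lambda312 : Set (Form 3) := {T | tau (tau T) = -T ∧ actJ T = hodge T}

/-- The orthogonal complement `m` of `u(3) = {η | J η = η}` in `so(6) = Λ²(ℝ⁶)`. -/
def mSpace : Submodule ℝ (Form 2) where
  carrier := {η | actJ η = -η}
  add_mem' {a b} ha hb := by
    simp only [Set.mem_ofPred_eq, actJ] at *
    rw [AlternatingMap.add_compLinearMap, ha, hb]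
    abel
  zero_mem' := by simp [actJ]
  smul_mem' c a ha := by
    simp only [Set.mem_ofPred_eq, actJ] at *
    ext v
    have := congrArg (fun f : Form 2 => f v) ha
    simp at this
    simp [this]

theorem stdJ_stdJ (v : R6) : stdJ (stdJ v) = -v := by
  ext i
  fin_cases i <;> simp [stdJ]

/-- The orthogonal projection `so(6) → m` along `u(3)`. -/
def prM : Form 2 →ₗ[ℝ] mSpace where
  toFun η := ⟨(1 / 2 : ℝ) • (η - actJ η), by
    change actJ _ = _
    ext v
    have : η (fun i => stdJ (stdJ (v i))) = η v := by
      have h : (fun i => stdJ (stdJ (v i))) = fun i => (-1 : ℝ) • v i := by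
        ext1 i
        rw [stdJ_stdJ, neg_one_smul]
      rw [h]
      have := η.toMultilinearMap.map_smul_univ (fun _ => (-1 : ℝ)) v
      simpa using this
    simp [actJ, this]
    ring⟩
  map_add' a b := by
    ext v
    simp [actJ]
    ring
  map_smul' c a := by
    ext v
    simp [actJ]
    ring

open TensorProduct

/-- The map `Θ(T) = ∑ e_i ⊗ pr_m(e_i ⌟ T)`. -/
def Theta (T : Form 3) : R6 ⊗[ℝ] mSpace := ∑ i, stdVec i ⊗ₜ[ℝ] prM (contract (stdVec i) T)

/-- The total antisymmetrization `Φ(x ⊗ η) = x ∧ η`. -/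
def Phi : R6 ⊗[ℝ] mSpace →ₗ[ℝ] Form 3 :=
  TensorProduct.lift (LinearMap.mk₂ ℝ (fun x α => wedge (flat x) (α : Form 2))
    (fun x y α => by ext v; simp [wedge_apply, inner_add_left]; ring)
    (fun c x α => by ext v; simp [wedge_apply, real_inner_smul_left]; ring)
    (fun x α β => by ext v; simp [wedge_apply]; ring)
    (fun c x α => by ext v; simp [wedge_apply]; ring))

/-- The component `𝒲₂ = ker Φ` of `ℝ⁶ ⊗ m`. -/
def W2 : Submodule ℝ (R6 ⊗[ℝ] mSpace) := LinearMap.ker Phi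

end Algebra

section Manifold

variable (M : Type*) [TopologicalSpace M] [ChartedSpace R6 M] [IsManifold 𝓘(ℝ, R6) ∞ M]
  [RiemannianBundle (fun x : M => TangentSpace 𝓘(ℝ, R6) x)]
  [IsContMDiffRiemannianBundle 𝓘(ℝ, R6) ∞ R6 (fun x : M => TangentSpace 𝓘(ℝ, R6) x)]

/-- An almost hermitian structure on a Riemannian 6-manifold: a smooth orthogonal almost complex
structure `J`. -/
structure AlmostHermitianStructure where
  J : Π x : M, TangentSpace 𝓘(ℝ, R6) x →L[ℝ] TangentSpace 𝓘(ℝ, R6) x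
  contMDiff_J : ContMDiff 𝓘(ℝ, R6) (𝓘(ℝ, R6).prod 𝓘(ℝ, R6 →L[ℝ] R6)) ∞
    (fun x => TotalSpace.mk' (R6 →L[ℝ] R6)
      (E := fun x : M => TangentSpace 𝓘(ℝ, R6) x →L[ℝ] TangentSpace 𝓘(ℝ, R6) x) x (J x))
  J_J : ∀ (x : M) (v : TangentSpace 𝓘(ℝ, R6) x), J x (J x v) = -v
  inner_J_J : ∀ (x : M) (v w : TangentSpace 𝓘(ℝ, R6) x), inner ℝ (J x v) (J x w) = inner ℝ v w

variable {M}

namespace AlmostHermitianStructure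

variable (A : AlmostHermitianStructure M)

theorem inner_J_self (x : M) (v : TangentSpace 𝓘(ℝ, R6) x) : inner ℝ (A.J x v) v = 0 := by
  have h := A.inner_J_J x (A.J x v) v
  rw [A.J_J, inner_neg_left, real_inner_comm] at h
  linarith

/-- The Kähler form `Ω(v, w) = g(J v, w)`. -/
def kahlerForm (x : M) : TangentSpace 𝓘(ℝ, R6) x [⋀^Fin 2]→L[ℝ] ℝ where
  toFun v := inner ℝ (A.J x (v 0)) (v 1)
  map_update_add' v i x y := by
    fin_cases i <;> simp [inner_add_left, inner_add_right]
  map_update_smul' v i c x := by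
    fin_cases i <;> simp [real_inner_smul_left, real_inner_smul_right]
  map_eq_zero_of_eq' v i j h hij := by
    have : v 0 = v 1 := by
      fin_cases i <;> fin_cases j <;> simp_all
    rw [this]
    exact A.inner_J_self _ _
  cont := by
    exact ((A.J x).continuous.comp (continuous_apply 0)).inner (continuous_apply 1)

/-- A local section around `p` of the reduction of the frame bundle to `U(3)`: smooth orthonormal
vector fields `e_1, …, e_6` on an open neighbourhood `U` of `p` with `J e_{2i-1} = e_{2i}`. -/
structure AdaptedFrame (p : M) where
  U : Set M
  isOpen_U : IsOpen U
  mem_U : p ∈ U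
  e : Fin 6 → Π x : M, TangentSpace 𝓘(ℝ, R6) x
  contMDiffOn_e : ∀ i, ContMDiffOn 𝓘(ℝ, R6) (𝓘(ℝ, R6).prod 𝓘(ℝ, R6)) ∞
    (fun x => TotalSpace.mk' R6 (E := fun x : M => TangentSpace 𝓘(ℝ, R6) x) x (e i x)) U
  orthonormal : ∀ x ∈ U, Orthonormal ℝ (fun i => e i x)
  J_e0 : ∀ x ∈ U, A.J x (e 0 x) = e 1 x
  J_e2 : ∀ x ∈ U, A.J x (e 2 x) = e 3 x
  J_e4 : ∀ x ∈ U, A.J x (e 4 x) = e 5 x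

namespace AdaptedFrame

open TensorProduct

variable {A} {p : M} (f : A.AdaptedFrame p)

/-- The frame at `p`, viewed as the isometry `ℝ⁶ → T_pM` that maps `e_i` to the `i`-th vector. -/
def toTangent : R6 →ₗ[ℝ] TangentSpace 𝓘(ℝ, R6) p :=
  ∑ i, ((innerₗ R6 (stdVec i)).smulRight (f.e i p))

/-- The Levi-Civita connection form in the frame, `Z(v) = ∑_{i < j} g(∇_v e_i, e_j) e_{ij}`,
as an element of `so(6) = Λ²(ℝ⁶)`. -/
def connectionForm (v : TangentSpace 𝓘(ℝ, R6) p) : Form 2 :=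
  ∑ i, ∑ j ∈ Finset.Ioi i, (inner ℝ (leviCivita (f.e i) p v) (f.e j p) : ℝ) •
    wedge (flat (stdVec i)) (flat (stdVec j))

/-- The intrinsic torsion at `p`, the `m`-part of the Levi-Civita connection form, in the frame:
`Γ = ∑ e_i ⊗ pr_m(Z(e_i))`. -/
def intrinsicTorsion : R6 ⊗[ℝ] mSpace :=
  ∑ i, stdVec i ⊗ₜ[ℝ] prM (f.connectionForm (f.e i p))

/-- The differential `dΩ` at `p` in the frame, as a 3-form on `ℝ⁶`. -/
def dOmega : Form 3 :=
  (exteriorDerivative A.kahlerForm p).toAlternatingMap.compLinearMap f.toTangent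

/-- The codifferential `δΩ` at `p` in the frame, as a vector in `ℝ⁶`. -/
def deltaOmega : R6 := WithLp.toLp 2 fun i => codifferential A.kahlerForm p ![f.e i p]

end AdaptedFrame

end AlmostHermitianStructure

end Manifold
end AlmostHermitian

end

open AlmostHermitian

/-! Both `dΩ` and `δΩ` are read off from `∇Ω`: since `∇` has no torsion, `dΩ` is the alternation of
`∇Ω` (`exteriorDerivative_apply`), and `δΩ` is minus its trace over any orthonormal basis. In an
adapted frame the components of `Ω` are constant, so `(∇_v Ω)(x, y) = Z(v)(x, Jy) + Z(v)(Jx, y)`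
with `Z` the connection form. This expression kills the `u(3)`-part of `Z(v)` and doubles the
`m`-part, so `(∇_u Ω)(x, y) = 2 Γ(u; x, Jy)` (`nablaKahler_eq_comps`). Hence `dΩ` and `δΩ` are
additive functions `altJ` and `traceJ` of `Γ`.

The rest is algebra. Membership in `W2` means that the alternation of `Γ` vanishes; with `Γ(u; Jx,
y) = Γ(u; x, Jy)` this forces `altJ` and `traceJ` to vanish. For `Γ = Θ(T)`, `altJ` is twice the
derivation action `derJ` of `J` on `T`, and `derJ = -τ`. If `τ²T = cT`, then `derJ T = (c + 3)/2 ·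
J(T)`; with `J(T) = *T` this is `-3 *T` for `c = -9` and `*T` for `c = -1`. On `X ∧ Ω` it is `-JX ∧
Ω = -*(X ∧ Ω)`. Doubling gives the coefficients `-6`, `2`, `-2`. Finally `traceJ (Θ T)` is a
contraction of `T` with `Ω`: it vanishes when `J(T) = *T`, and gives `-4X` on `X ∧ Ω`. -/

noncomputable section

namespace AlmostHermitian

/-! ### The covariant derivative of a 2-form as a tensor -/

section TwoForms

variable {E : Type*} [NormedAddCommGroup E] [NormedSpace ℝ E]
  {M : Type*} [TopologicalSpace M] [ChartedSpace E M]

/-- A 2-form is differentiable at `p` if its values on differentiable vector fields are. -/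
def MDiffTwoFormAt [IsManifold 𝓘(ℝ, E) ∞ M]
    (η : Π x : M, TangentSpace 𝓘(ℝ, E) x [⋀^Fin 2]→L[ℝ] ℝ) (p : M) : Prop :=
  ∀ Y Z : Π x : M, TangentSpace 𝓘(ℝ, E) x, MDiffAt (T% Y) p → MDiffAt (T% Z) p →
    MDiffAt (fun x => η x ![Y x, Z x]) p

theorem twoForm_add_left {V : Type*} [AddCommGroup V] [Module ℝ V] [TopologicalSpace V]
    (η : V [⋀^Fin 2]→L[ℝ] ℝ) (a b c : V) : η ![a + b, c] = η ![a, c] + η ![b, c] :=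
  η.toMultilinearMap.cons_add ![c] a b

theorem twoForm_smul_left {V : Type*} [AddCommGroup V] [Module ℝ V] [TopologicalSpace V]
    (η : V [⋀^Fin 2]→L[ℝ] ℝ) (r : ℝ) (a c : V) : η ![r • a, c] = r * η ![a, c] :=
  η.toMultilinearMap.cons_smul ![c] r a

theorem twoForm_swap {V : Type*} [AddCommGroup V] [Module ℝ V] [TopologicalSpace V]
    (η : V [⋀^Fin 2]→L[ℝ] ℝ) (a b : V) : η ![a, b] = -η ![b, a] := by
  have := η.map_swap ![b, a] (i := 0) (j := 1) (by simp)
  refine Eq.trans (congrArg η ?_) this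
  ext i; fin_cases i <;> rfl

theorem twoForm_add_right {V : Type*} [AddCommGroup V] [Module ℝ V] [TopologicalSpace V]
    (η : V [⋀^Fin 2]→L[ℝ] ℝ) (a b c : V) : η ![a, b + c] = η ![a, b] + η ![a, c] := by
  rw [twoForm_swap, twoForm_add_left, twoForm_swap η b, twoForm_swap η c]
  ring

theorem twoForm_smul_right {V : Type*} [AddCommGroup V] [Module ℝ V] [TopologicalSpace V]
    (η : V [⋀^Fin 2]→L[ℝ] ℝ) (r : ℝ) (a c : V) : η ![a, r • c] = r * η ![a, c] := by
  rw [twoForm_swap, twoForm_smul_left, twoForm_swap η c]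
  ring

variable [FiniteDimensional ℝ E] [IsManifold 𝓘(ℝ, E) ∞ M]
  [RiemannianBundle (fun x : M => TangentSpace 𝓘(ℝ, E) x)]
  [IsContMDiffRiemannianBundle 𝓘(ℝ, E) ∞ E (fun x : M => TangentSpace 𝓘(ℝ, E) x)]
  [CompleteSpace E]

/-- The expression `v(η(Y, Z)) - η(∇_v Y, Z) - η(Y, ∇_v Z)` for vector fields `Y`, `Z`. -/
def nablaFields (η : Π x : M, TangentSpace 𝓘(ℝ, E) x [⋀^Fin 2]→L[ℝ] ℝ) (p : M)
    (v : TangentSpace 𝓘(ℝ, E) p) (Y Z : Π x : M, TangentSpace 𝓘(ℝ, E) x) : ℝ :=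
  d% (fun x => η x ![Y x, Z x]) p v
    - η p ![leviCivita Y p v, Z p] - η p ![Y p, leviCivita Z p v]

variable {η : Π x : M, TangentSpace 𝓘(ℝ, E) x [⋀^Fin 2]→L[ℝ] ℝ} {p : M}

theorem nablaFields_swap (v : TangentSpace 𝓘(ℝ, E) p) (Y Z : Π x : M, TangentSpace 𝓘(ℝ, E) x) :
    nablaFields η p v Y Z = -nablaFields η p v Z Y := by
  have h : (fun x => η x ![Y x, Z x]) = -fun x => η x ![Z x, Y x] := by
    ext x
    exact twoForm_swap _ _ _
  rw [nablaFields, nablaFields, h, mvfderiv_neg, twoForm_swap _ (leviCivita Y p v),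
    twoForm_swap _ (Y p)]
  simp only [_root_.neg_apply]
  ring

/-- The term `df(v) η(Y, Z)` from differentiating `η(fY, Z)` cancels the one from the Leibniz rule
for `∇_v (fY)`. Tensoriality is what later allows adapted frame fields and coordinate fields to
replace the canonical extensions in `covDerivForm`. -/
theorem tensorialAt_nablaFields_left (hη : MDiffTwoFormAt η p) (v : TangentSpace 𝓘(ℝ, E) p)
    {Z : Π x : M, TangentSpace 𝓘(ℝ, E) x} (hZ : MDiffAt (T% Z) p) :
    TensorialAt 𝓘(ℝ, E) E (fun Y => nablaFields η p v Y Z) p where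
  smul {f Y} hf hY := by
    have h1 := mvfderiv_fun_mul hf (hη Y Z hY hZ)
    have h2 := leviCivita.isCovariantDerivativeOn.leibniz hY hf
    simp only [nablaFields, Pi.smul_apply', twoForm_smul_left, h1]
    erw [h2]
    simp only [_root_.add_apply, _root_.smul_apply, ContinuousLinearMap.smulRight_apply,
      twoForm_add_left, twoForm_smul_left, smul_eq_mul]
    ring
  add {Y Y'} hY hY' := by
    have h1 := mvfderiv_fun_add (hη Y Z hY hZ) (hη Y' Z hY' hZ)
    have h2 := leviCivita.isCovariantDerivativeOn.add hY hY'
    simp only [nablaFields, Pi.add_apply, twoForm_add_left, h1]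
    erw [h2]
    simp only [_root_.add_apply, twoForm_add_left]
    ring

theorem tensorialAt_nablaFields_right (hη : MDiffTwoFormAt η p) (v : TangentSpace 𝓘(ℝ, E) p)
    {Y : Π x : M, TangentSpace 𝓘(ℝ, E) x} (hY : MDiffAt (T% Y) p) :
    TensorialAt 𝓘(ℝ, E) E (fun Z => nablaFields η p v Y Z) p where
  smul {f Z} hf hZ := by
    rw [nablaFields_swap, (tensorialAt_nablaFields_left hη v hY).smul hf hZ,
      nablaFields_swap v Y Z, smul_neg]
  add {Z Z'} hZ hZ' := by
    rw [nablaFields_swap, (tensorialAt_nablaFields_left hη v hY).add hZ hZ',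
      nablaFields_swap v Y Z, nablaFields_swap v Y Z', neg_add]

/-- The bilinear form `(a, b) ↦ (∇_v η)(a, b)`. -/
def nablaForm (hη : MDiffTwoFormAt η p) (v : TangentSpace 𝓘(ℝ, E) p) :
    TangentSpace 𝓘(ℝ, E) p →L[ℝ] TangentSpace 𝓘(ℝ, E) p →L[ℝ] ℝ :=
  TensorialAt.mkHom₂ (I := 𝓘(ℝ, E)) (F := E) (F' := E) (nablaFields η p v) p
    (fun _ hZ => tensorialAt_nablaFields_left hη v hZ)
    (fun _ hY => tensorialAt_nablaFields_right hη v hY)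

theorem nablaForm_apply (hη : MDiffTwoFormAt η p) (v : TangentSpace 𝓘(ℝ, E) p)
    {Y Z : Π x : M, TangentSpace 𝓘(ℝ, E) x} (hY : MDiffAt (T% Y) p) (hZ : MDiffAt (T% Z) p) :
    nablaForm hη v (Y p) (Z p) = nablaFields η p v Y Z :=
  TensorialAt.mkHom₂_apply (I := 𝓘(ℝ, E)) (F := E) (F' := E)
    (fun _ hZ => tensorialAt_nablaFields_left hη v hZ)
    (fun _ hY => tensorialAt_nablaFields_right hη v hY) hY hZ

/-- The extensions of `a` and `b` do not involve `v`, so linearity in `v` can be read off this form.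
-/
theorem nablaForm_eq_nablaFields_extend (hη : MDiffTwoFormAt η p)
    (v a b : TangentSpace 𝓘(ℝ, E) p) :
    nablaForm hη v a b
      = nablaFields η p v (FiberBundle.extend E a) (FiberBundle.extend E b) :=
  rfl

theorem nablaForm_add (hη : MDiffTwoFormAt η p) (v w a b : TangentSpace 𝓘(ℝ, E) p) :
    nablaForm hη (v + w) a b = nablaForm hη v a b + nablaForm hη w a b := by
  simp only [nablaForm_eq_nablaFields_extend, nablaFields, map_add, twoForm_add_left,
    twoForm_add_right]
  ring

theorem nablaForm_smul (hη : MDiffTwoFormAt η p) (c : ℝ) (v a b : TangentSpace 𝓘(ℝ, E) p) :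
    nablaForm hη (c • v) a b = c * nablaForm hη v a b := by
  simp only [nablaForm_eq_nablaFields_extend, nablaFields, map_smul, twoForm_smul_left,
    twoForm_smul_right, smul_eq_mul]
  ring

theorem covDerivForm_eq_nablaForm (hη : MDiffTwoFormAt η p) (v a b : TangentSpace 𝓘(ℝ, E) p) :
    covDerivForm η p v ![a, b] = nablaForm hη v a b := by
  have h0 : ∀ c, Function.update ![a, b] 0 c = ![c, b] := fun c => by
    ext i; fin_cases i <;> rfl
  have h1 : ∀ c, Function.update ![a, b] 1 c = ![a, c] := fun c => by
    ext i; fin_cases i <;> rfl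
  have h2 : (fun x => η x fun i => FiberBundle.extend E (![a, b] i) x)
      = fun x => η x ![FiberBundle.extend E a x, FiberBundle.extend E b x] := by
    ext x; congr 1; ext i; fin_cases i <;> rfl
  rw [nablaForm_eq_nablaFields_extend, nablaFields, covDerivForm, h2, Fin.sum_univ_two, h0, h1,
    FiberBundle.extend_apply_self, FiberBundle.extend_apply_self, ← sub_sub]
  rfl

end TwoForms

/-! ### Exterior derivative and covariant derivative, compared through coordinate fields -/

section ChartForms

variable {E : Type*} [NormedAddCommGroup E] [NormedSpace ℝ E] [FiniteDimensional ℝ E]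

/-- In finite dimension, evaluation on pairs of basis vectors embeds the 2-forms linearly into a
coordinate space; a linear left inverse recovers `ζ` from finitely many differentiable functions. -/
theorem differentiableAt_twoForm {ζ : E → E [⋀^Fin 2]→L[ℝ] ℝ} {y : E}
    (h : ∀ a b : E, DifferentiableAt ℝ (fun z => ζ z ![a, b]) y) : DifferentiableAt ℝ ζ y := by
  let b := Module.finBasis ℝ E
  let ι := Fin 2 → Fin (Module.finrank ℝ E)
  let L : (E [⋀^Fin 2]→L[ℝ] ℝ) →ₗ[ℝ] (ι → ℝ) :=
    { toFun := fun α s => α (fun i => b (s i))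
      map_add' := fun _ _ => rfl
      map_smul' := fun _ _ => rfl }
  have hL : LinearMap.ker L = ⊥ := by
    rw [LinearMap.ker_eq_bot']
    intro α hα
    refine ContinuousAlternatingMap.toAlternatingMap_injective ?_
    refine AlternatingMap.coe_multilinearMap_injective ?_
    exact Module.Basis.ext_multilinear (fun _ => b) fun s => congrFun hα s
  obtain ⟨G, hG⟩ := L.exists_leftInverse_of_injective hL
  have h1 : DifferentiableAt ℝ (fun z => L (ζ z)) y := by
    refine differentiableAt_pi.2 fun s => ?_
    have : (fun z => L (ζ z) s) = fun z => ζ z ![b (s 0), b (s 1)] := by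
      ext z
      refine congrArg (ζ z) ?_
      ext i; fin_cases i <;> rfl
    rw [this]
    exact h _ _
  have h2 : ζ = fun z => LinearMap.toContinuousLinearMap G (L (ζ z)) := by
    ext1 z
    exact (LinearMap.congr_fun hG (ζ z)).symm
  rw [h2]
  exact (LinearMap.toContinuousLinearMap G).differentiableAt.comp y h1

variable {M : Type*} [TopologicalSpace M] [ChartedSpace E M] [IsManifold 𝓘(ℝ, E) ∞ M]

/-- The constant vector field `u` on a vector space. -/
def constField (u : E) : Π y : E, TangentSpace 𝓘(ℝ, E) y := fun _ => u

/-- The vector field whose coordinate expression in the chart at `p` is the constant `u`. -/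
def coordField (p : M) (u : E) : Π x : M, TangentSpace 𝓘(ℝ, E) x :=
  VectorField.mpullback 𝓘(ℝ, E) 𝓘(ℝ, E) (extChartAt 𝓘(ℝ, E) p) (constField u)

theorem mdiffAt_constField (y u : E) : MDiffAt (T% (constField u)) y :=
  (contMDiffAt_vectorSpace_iff_contDiffAt.2
    (contDiffAt_const (n := 1) : ContDiffAt ℝ 1 (fun _ : E => u) y)).mdifferentiableAt one_ne_zero

theorem mdiffAt_coordField (p : M) (u : E) : MDiffAt (T% (coordField p u)) p := by
  have : CompleteSpace E := FiniteDimensional.complete ℝ E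
  exact MDifferentiableAt.mpullback_vectorField (n := ∞) (V := constField u)
    (mdiffAt_constField _ u)
    contMDiffAt_extChartAt (isInvertible_mfderiv_extChartAt (mem_extChartAt_source p))
    (by norm_cast)

/-- Lie brackets are natural under pullback, and constant fields on `E` commute. -/
theorem mlieBracket_coordField (p : M) (u w : E) :
    VectorField.mlieBracket 𝓘(ℝ, E) (coordField p u) (coordField p w) p = 0 := by
  have : CompleteSpace E := FiniteDimensional.complete ℝ E
  have : IsManifold 𝓘(ℝ, E) (minSmoothness ℝ 2) M := by
    rw [minSmoothness_of_isRCLikeNormedField]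
    exact IsManifold.of_le (n := ∞) (by norm_cast)
  have h := VectorField.mpullback_mlieBracket (n := ∞) (I := 𝓘(ℝ, E)) (I' := 𝓘(ℝ, E))
    (V := constField u) (W := constField w)
    (mdiffAt_constField (extChartAt 𝓘(ℝ, E) p p) u) (mdiffAt_constField _ w)
    (contMDiffAt_extChartAt (I := 𝓘(ℝ, E)) (x := p))
    (by rw [minSmoothness_of_isRCLikeNormedField]; norm_cast)
  refine h.symm.trans ?_
  rw [VectorField.mpullback_apply, ← VectorField.mlieBracketWithin_univ,
    VectorField.mlieBracketWithin_eq_lieBracketWithin]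
  have h0 : VectorField.lieBracketWithin ℝ (fun _ : E => u) (fun _ => w) Set.univ
      (extChartAt 𝓘(ℝ, E) p p) = 0 := by
    simp [VectorField.lieBracketWithin]
  exact (congrArg _ h0).trans (map_zero _)

/-- The pullback inverts the derivative of the chart, whereas `exteriorDerivative` uses the
derivative of the inverse chart; this matches the two. -/
theorem coordField_eq {p x : M} (hx : x ∈ (extChartAt 𝓘(ℝ, E) p).source) (u : E) :
    coordField p u x
      = mfderiv 𝓘(ℝ, E) 𝓘(ℝ, E) (extChartAt 𝓘(ℝ, E) p).symm (extChartAt 𝓘(ℝ, E) p x) u := by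
  have h1 := mfderiv_extChartAt_comp_mfderivWithin_extChartAt_symm' (I := 𝓘(ℝ, E)) hx
  have h2 := mfderivWithin_extChartAt_symm_comp_mfderiv_extChartAt' (I := 𝓘(ℝ, E)) hx
  rw [modelWithCornersSelf_coe, Set.range_id, mfderivWithin_univ] at h1 h2
  rw [coordField, VectorField.mpullback_apply]
  rw [ContinuousLinearMap.inverse_eq h1 h2]
  rfl

theorem coordField_self (p : M) (u : E) : coordField p u p = u := by
  rw [coordField, VectorField.mpullback_apply, mfderiv_extChartAt_self]
  exact DFunLike.congr_fun (ContinuousLinearMap.inverse_id (R := ℝ) (M := E)) u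

theorem differentiableAt_comp_extChartAt_symm {p : M} {g : M → ℝ} (hg : MDiffAt g p) :
    DifferentiableAt ℝ (g ∘ (extChartAt 𝓘(ℝ, E) p).symm) (extChartAt 𝓘(ℝ, E) p p) := by
  have := hg.differentiableWithinAt_writtenInExtChartAt
  rwa [modelWithCornersSelf_coe, Set.range_id, differentiableWithinAt_univ] at this

theorem mvfderiv_eq_fderiv_chart {p : M} {g : M → ℝ} (hg : MDiffAt g p)
    (v : TangentSpace 𝓘(ℝ, E) p) :
    d% g p v = fderiv ℝ (g ∘ (extChartAt 𝓘(ℝ, E) p).symm) (extChartAt 𝓘(ℝ, E) p p) v := by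
  have h : mfderiv 𝓘(ℝ, E) 𝓘(ℝ, ℝ) g p
      = fderiv ℝ (g ∘ (extChartAt 𝓘(ℝ, E) p).symm) (extChartAt 𝓘(ℝ, E) p p) := by
    rw [hg.mfderiv, modelWithCornersSelf_coe, Set.range_id, fderivWithin_univ]
    rfl
  exact congrArg (fun L : E →L[ℝ] ℝ => L v) h

variable [RiemannianBundle (fun x : M => TangentSpace 𝓘(ℝ, E) x)]
  [IsContMDiffRiemannianBundle 𝓘(ℝ, E) ∞ E (fun x : M => TangentSpace 𝓘(ℝ, E) x)]
  [CompleteSpace E]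

theorem leviCivita_coordField_comm (p : M) (u w : E) :
    leviCivita (coordField p u) p (coordField p w p)
      = leviCivita (coordField p w) p (coordField p u p) := by
  have h := (CovariantDerivative.torsion_eq_zero_iff _).1
    (leviCivita_torsion (E := E) (M := M)) (mdiffAt_coordField p u) (mdiffAt_coordField p w)
  rw [mlieBracket_coordField, sub_eq_zero] at h
  exact h.symm

/-- The exterior derivative of a 2-form is the alternation of its covariant derivative. -/
theorem exteriorDerivative_apply {η : Π x : M, TangentSpace 𝓘(ℝ, E) x [⋀^Fin 2]→L[ℝ] ℝ} {p : M}
    (hη : MDiffTwoFormAt η p) (a b c : TangentSpace 𝓘(ℝ, E) p) :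
    exteriorDerivative η p ![a, b, c]
      = nablaForm hη a b c - nablaForm hη b a c + nablaForm hη c a b := by
  set φ := extChartAt 𝓘(ℝ, E) p with hφ
  set ζ : E → E [⋀^Fin 2]→L[ℝ] ℝ := fun y => (η (φ.symm y)).compContinuousLinearMap
      (mfderiv 𝓘(ℝ, E) 𝓘(ℝ, E) φ.symm y : E →L[ℝ] TangentSpace 𝓘(ℝ, E) (φ.symm y)) with hζ
  have hg : ∀ u w : E, MDiffAt (fun x => η x ![coordField p u x, coordField p w x]) p :=
    fun u w => hη _ _ (mdiffAt_coordField p u) (mdiffAt_coordField p w)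
  -- The coefficients of the coordinate expression are the values of `η` on coordinate fields. The
  -- equality is needed only near `φ p`, where the chart identities hold.
  have hev : ∀ u w : E, (fun y => ζ y ![u, w]) =ᶠ[nhds (φ p)]
      (fun x => η x ![coordField p u x, coordField p w x]) ∘ φ.symm := by
    intro u w
    filter_upwards [extChartAt_target_mem_nhds (I := 𝓘(ℝ, E)) p] with y hy
    have hx := φ.map_target hy
    rw [Function.comp_apply, coordField_eq hx, coordField_eq hx, ← hφ, φ.right_inv hy]
    refine congrArg (η (φ.symm y)) ?_
    ext i; fin_cases i <;> rfl
  have hd : DifferentiableAt ℝ ζ (φ p) := differentiableAt_twoForm fun u w =>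
    (hev u w).differentiableAt_iff.2 (differentiableAt_comp_extChartAt_symm (hg u w))
  have key : ∀ u v w : E, fderiv ℝ (fun y => ζ y ![v, w]) (φ p) u
      = nablaForm hη (u : TangentSpace 𝓘(ℝ, E) p) v w
        + η p ![leviCivita (coordField p v) p u, w] + η p ![v, leviCivita (coordField p w) p u] := by
    intro u v w
    rw [(hev v w).fderiv_eq]
    have h1 := mvfderiv_eq_fderiv_chart (hg v w) u
    have h2 := nablaForm_apply hη u (mdiffAt_coordField p v) (mdiffAt_coordField p w)
    unfold nablaFields at h2
    rw [coordField_self, coordField_self] at h2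
    rw [← h1, h2]
    ring
  have h0 : exteriorDerivative η p ![a, b, c] = extDeriv ζ (φ p) ![a, b, c] := by
    rw [exteriorDerivative, mfderiv_extChartAt_self]
    rfl
  have r0 : (Fin.removeNth 0 ![a, b, c] : Fin 2 → TangentSpace 𝓘(ℝ, E) p) = ![b, c] := by
    ext i; fin_cases i <;> rfl
  have r1 : (Fin.removeNth 1 ![a, b, c] : Fin 2 → TangentSpace 𝓘(ℝ, E) p) = ![a, c] := by
    ext i; fin_cases i <;> rfl
  have r2 : (Fin.removeNth 2 ![a, b, c] : Fin 2 → TangentSpace 𝓘(ℝ, E) p) = ![a, b] := by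
    ext i; fin_cases i <;> rfl
  have comm : ∀ u w : E, leviCivita (coordField p u) p w = leviCivita (coordField p w) p u := by
    intro u w
    have := leviCivita_coordField_comm p u w
    rwa [coordField_self, coordField_self] at this
  rw [h0]
  refine (extDeriv_apply hd _).trans ?_
  rw [Fin.sum_univ_three]
  erw [r0, r1, r2, key, key, key]
  -- The six correction terms `η(∇·, ·)` from `key` cancel in pairs under alternation, because `∇`
  -- is symmetric on commuting coordinate fields.
  have e1 := congrArg (fun z : TangentSpace 𝓘(ℝ, E) p => η p ![z, c]) (comm a b)
  have e2 := congrArg (fun z : TangentSpace 𝓘(ℝ, E) p => η p ![z, b]) (comm a c)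
  have e3 := congrArg (fun z : TangentSpace 𝓘(ℝ, E) p => η p ![a, z]) (comm b c)
  have e4 : ∀ z, η p ![b, z] = -η p ![z, b] := twoForm_swap (η p) b
  simp at e1 e2 e3 ⊢
  rw [e4]
  linarith

end ChartForms

/-! ### Traces and evaluation of forms -/

/-- Basis independence of the metric trace lets the basis in `codifferential` be replaced by the
adapted frame. -/
theorem sum_apply_orthonormalBasis {V ι κ : Type*} [Fintype ι] [Fintype κ] [NormedAddCommGroup V]
    [InnerProductSpace ℝ V] (B : V →ₗ[ℝ] V →ₗ[ℝ] ℝ) (b : OrthonormalBasis ι ℝ V)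
    (e : OrthonormalBasis κ ℝ V) : ∑ i, B (b i) (b i) = ∑ k, B (e k) (e k) := by
  have h : ∀ i, B (b i) (b i) = ∑ k, ∑ l, inner ℝ (e k) (b i) * inner ℝ (b i) (e l) * B (e k) (e l) := by
    intro i
    conv_lhs => rw [← e.sum_repr' (b i)]
    simp only [map_sum, map_smul, LinearMap.sum_apply, LinearMap.smul_apply, smul_eq_mul,
      Finset.mul_sum]
    rw [Finset.sum_comm]
    refine Finset.sum_congr rfl fun k _ => Finset.sum_congr rfl fun l _ => ?_
    rw [real_inner_comm (e l) (b i)]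
    ring
  classical
  simp_rw [h]
  rw [Finset.sum_comm]
  refine Finset.sum_congr rfl fun k _ => ?_
  rw [Finset.sum_comm]
  simp_rw [← Finset.sum_mul, b.sum_inner_mul_inner, orthonormal_iff_ite.1 e.orthonormal]
  simp

theorem inner_stdVec (i : Fin 6) (x : R6) : inner ℝ (stdVec i) x = x i := by
  rw [stdVec, EuclideanSpace.inner_single_left]
  simp

theorem form_sum_apply {ι : Type*} {k : ℕ} (s : Finset ι) (η : ι → Form k) (v : Fin k → R6) :
    (∑ i ∈ s, η i) v = ∑ i ∈ s, η i v :=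
  map_sum (⟨⟨fun α => α v, rfl⟩, fun _ _ => rfl⟩ : Form k →+ ℝ) η s

/-! ### The covariant derivative of the Kähler form in an adapted frame -/

section Manifold

variable {M : Type*} [TopologicalSpace M] [ChartedSpace R6 M] [IsManifold 𝓘(ℝ, R6) ∞ M]
  [RiemannianBundle (fun x : M => TangentSpace 𝓘(ℝ, R6) x)]
  [IsContMDiffRiemannianBundle 𝓘(ℝ, R6) ∞ R6 (fun x : M => TangentSpace 𝓘(ℝ, R6) x)]

namespace AlmostHermitianStructure

variable (A : AlmostHermitianStructure M)

theorem mdiffTwoFormAt_kahlerForm (p : M) : MDiffTwoFormAt A.kahlerForm p := by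
  intro Y Z hY hZ
  refine mdiffAt_inner (Y := fun y => A.J y (Y y)) ?_ hZ
  exact MDifferentiableAt.clm_bundle_apply (F₁ := R6) (F₂ := R6)
    (E₁ := fun x : M => TangentSpace 𝓘(ℝ, R6) x) (E₂ := fun x : M => TangentSpace 𝓘(ℝ, R6) x)
    ((A.contMDiff_J p).mdifferentiableAt (by simp)) hY

/-- The covariant derivative of the Kähler form. -/
def nablaKahler (p : M) (v : TangentSpace 𝓘(ℝ, R6) p) :
    TangentSpace 𝓘(ℝ, R6) p →L[ℝ] TangentSpace 𝓘(ℝ, R6) p →L[ℝ] ℝ :=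
  nablaForm (A.mdiffTwoFormAt_kahlerForm p) v

theorem inner_J_left (x : M) (v w : TangentSpace 𝓘(ℝ, R6) x) :
    inner ℝ (A.J x v) w = -inner ℝ v (A.J x w) := by
  have h := A.inner_J_J x v (A.J x w)
  rw [A.J_J, inner_neg_right] at h
  linarith

namespace AdaptedFrame

variable {A} {p : M} (f : A.AdaptedFrame p)

theorem J_e {x : M} (hx : x ∈ f.U) (i : Fin 6) :
    A.J x (f.e i x) = ∑ k, stdJ (stdVec i) k • f.e k x := by
  have h1 : A.J x (f.e 1 x) = -f.e 0 x := by rw [← f.J_e0 x hx, A.J_J]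
  have h3 : A.J x (f.e 3 x) = -f.e 2 x := by rw [← f.J_e2 x hx, A.J_J]
  have h5 : A.J x (f.e 5 x) = -f.e 4 x := by rw [← f.J_e4 x hx, A.J_J]
  have h0 := f.J_e0 x hx
  have h2 := f.J_e2 x hx
  have h4 := f.J_e4 x hx
  fin_cases i <;> simp [Fin.sum_univ_six, stdJ, stdVec, *]

theorem kahlerForm_e {x : M} (hx : x ∈ f.U) (i j : Fin 6) :
    A.kahlerForm x ![f.e i x, f.e j x] = stdJ (stdVec i) j := by
  change inner ℝ (A.J x (f.e i x)) (f.e j x) = _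
  rw [f.J_e hx, sum_inner]
  simp_rw [real_inner_smul_left, orthonormal_iff_ite.1 (f.orthonormal x hx)]
  simp

theorem mdiffAt_e (i : Fin 6) :
    MDifferentiableAt 𝓘(ℝ, R6) (𝓘(ℝ, R6).prod 𝓘(ℝ, R6))
      (fun x => TotalSpace.mk' R6 (E := fun x : M => TangentSpace 𝓘(ℝ, R6) x) x (f.e i x)) p :=
  ((f.contMDiffOn_e i).contMDiffAt (f.isOpen_U.mem_nhds f.mem_U)).mdifferentiableAt (by simp)

theorem mvfderiv_eq_zero {g : M → ℝ} {c : ℝ} (h : ∀ x ∈ f.U, g x = c) :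
    mvfderiv 𝓘(ℝ, R6) g p = 0 := by
  have h1 : g =ᶠ[nhds p] fun _ => c :=
    Filter.eventually_of_mem (f.isOpen_U.mem_nhds f.mem_U) h
  have h2 := mvfderiv_const (I := 𝓘(ℝ, R6)) c (x := p)
  rw [← h2]
  unfold mvfderiv
  rw [h1.mfderiv_eq]
  rfl

/-- The functions `g(e_i, e_j)` are constant near `p`, so metric compatibility makes the connection
coefficients skew. -/
theorem inner_leviCivita_e_swap (v : TangentSpace 𝓘(ℝ, R6) p) (i j : Fin 6) :
    (inner ℝ (leviCivita (f.e i) p v) (f.e j p) : ℝ)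
      = -inner ℝ (leviCivita (f.e j) p v) (f.e i p) := by
  have h := leviCivita_metric
    (FiberBundle.mdifferentiableAt_extend 𝓘(ℝ, R6) R6 v) (f.mdiffAt_e i) (f.mdiffAt_e j)
  rw [f.mvfderiv_eq_zero fun x hx => orthonormal_iff_ite.1 (f.orthonormal x hx) i j,
    FiberBundle.extend_apply_self, real_inner_comm _ (f.e i p)] at h
  rw [_root_.zero_apply] at h
  linarith

theorem toTangent_apply (u : R6) : f.toTangent u = ∑ i, u i • f.e i p := by
  simp [toTangent, inner_stdVec]

theorem toTangent_stdVec (i : Fin 6) : f.toTangent (stdVec i) = f.e i p := by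
  simp [toTangent_apply, stdVec]

theorem toTangent_stdJ (u : R6) : f.toTangent (stdJ u) = A.J p (f.toTangent u) := by
  have h : f.toTangent ∘ₗ stdJ = (A.J p).toLinearMap ∘ₗ f.toTangent := by
    refine (EuclideanSpace.basisFun (Fin 6) ℝ).toBasis.ext fun i => ?_
    have : (EuclideanSpace.basisFun (Fin 6) ℝ).toBasis i = stdVec i := by simp [stdVec]
    rw [this]
    simp only [LinearMap.comp_apply, ContinuousLinearMap.coe_coe, toTangent_stdVec, f.J_e f.mem_U]
    exact f.toTangent_apply _
  exact LinearMap.congr_fun h u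

/-- The covariant derivative in the direction `v` of the vector field with constant coefficients
`x` in the frame. -/
def frameDeriv (v : TangentSpace 𝓘(ℝ, R6) p) (x : R6) : TangentSpace 𝓘(ℝ, R6) p :=
  ∑ i, x i • leviCivita (f.e i) p v

/-- Skewness of the coefficients turns the sum over `i < j` of `x i * y j - x j * y i` into the full
double sum of `x i * y j`. -/
theorem connectionForm_apply (v : TangentSpace 𝓘(ℝ, R6) p) (x y : R6) :
    f.connectionForm v ![x, y] = inner ℝ (f.frameDeriv v x) (f.toTangent y) := by
  set c : Fin 6 → Fin 6 → ℝ := fun i j => inner ℝ (leviCivita (f.e i) p v) (f.e j p) with hc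
  have hw : ∀ i j, wedge (flat (stdVec i)) (flat (stdVec j)) ![x, y] = x i * y j - x j * y i := by
    intro i j
    simp [wedge, flat, AlternatingMap.alternatizeUncurryFin_apply, Fin.sum_univ_two,
      inner_stdVec, Fin.removeNth]
    ring
  have h1 : f.connectionForm v ![x, y]
      = ∑ i, ∑ j, if i < j then c i j * (x i * y j - x j * y i) else 0 := by
    simp only [connectionForm, form_sum_apply, AlternatingMap.smul_apply, hw,
      smul_eq_mul]
    refine Finset.sum_congr rfl fun i _ => ?_
    rw [← Finset.sum_filter]
    refine Finset.sum_congr (by ext; simp) fun j _ => rfl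
  have h2 : inner ℝ (f.frameDeriv v x) (f.toTangent y) = ∑ i, ∑ j, c i j * (x i * y j) := by
    rw [frameDeriv, toTangent_apply, sum_inner]
    refine Finset.sum_congr rfl fun i _ => ?_
    rw [inner_sum]
    refine Finset.sum_congr rfl fun j _ => ?_
    rw [real_inner_smul_left, real_inner_smul_right, hc]
    ring
  have h3 : ∑ i, ∑ j, (if i < j then c i j * (x j * y i) else 0)
      = ∑ i, ∑ j, if j < i then -(c i j * (x i * y j)) else 0 := by
    rw [Finset.sum_comm]
    refine Finset.sum_congr rfl fun i _ => Finset.sum_congr rfl fun j _ => ?_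
    have : c j i = -c i j := f.inner_leviCivita_e_swap v j i
    rw [this]
    simp
  have h4 : ∀ i j, (if i < j then c i j * (x i * y j - x j * y i) else 0)
      = (if i < j then c i j * (x i * y j) else 0) - if i < j then c i j * (x j * y i) else 0 := by
    intro i j
    split_ifs <;> ring
  rw [h1, h2]
  simp_rw [h4, Finset.sum_sub_distrib]
  rw [h3, ← Finset.sum_sub_distrib]
  refine Finset.sum_congr rfl fun i _ => ?_
  rw [← Finset.sum_sub_distrib]
  refine Finset.sum_congr rfl fun j _ => ?_
  rcases lt_trichotomy i j with h | h | h
  · simp [h, h.not_gt]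
  · have : c i j = -c j i := f.inner_leviCivita_e_swap v i j
    subst h
    have : c i i = 0 := by linarith
    simp [this]
  · simp [h, h.not_gt]

/-- The derivative term drops out because `Ω(e_i, e_j)` is constant on the domain of the frame; only
connection terms remain. -/
theorem nablaKahler_e (v : TangentSpace 𝓘(ℝ, R6) p) (i j : Fin 6) :
    A.nablaKahler p v (f.e i p) (f.e j p)
      = inner ℝ (leviCivita (f.e i) p v) (A.J p (f.e j p))
        - inner ℝ (leviCivita (f.e j) p v) (A.J p (f.e i p)) := by
  have h := nablaForm_apply (A.mdiffTwoFormAt_kahlerForm p) v (f.mdiffAt_e i) (f.mdiffAt_e j)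
  refine h.trans ?_
  unfold nablaFields
  rw [f.mvfderiv_eq_zero fun x hx => f.kahlerForm_e hx i j]
  change 0 - inner ℝ (A.J p (leviCivita (f.e i) p v)) (f.e j p)
    - inner ℝ (A.J p (f.e i p)) (leviCivita (f.e j) p v) = _
  rw [A.inner_J_left, real_inner_comm (leviCivita (f.e j) p v)]
  ring

theorem nablaKahler_toTangent (v : TangentSpace 𝓘(ℝ, R6) p) (x y : R6) :
    A.nablaKahler p v (f.toTangent x) (f.toTangent y)
      = f.connectionForm v ![x, stdJ y] + f.connectionForm v ![stdJ x, y] := by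
  have h : f.connectionForm v ![stdJ x, y] = -f.connectionForm v ![y, stdJ x] := by
    have := (f.connectionForm v).map_swap ![y, stdJ x] (i := 0) (j := 1) (by simp)
    refine Eq.trans (congrArg _ ?_) this
    ext i; fin_cases i <;> rfl
  rw [h, connectionForm_apply, connectionForm_apply, toTangent_stdJ, toTangent_stdJ]
  simp only [frameDeriv, toTangent_apply, map_sum, map_smul, sum_inner, inner_sum,
    real_inner_smul_left, real_inner_smul_right, _root_.sum_apply,
    _root_.smul_apply, nablaKahler_e, smul_eq_mul]
  simp only [Finset.mul_sum, mul_sub, Finset.sum_sub_distrib]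
  rw [← sub_eq_add_neg]
  refine congrArg₂ _ rfl ?_
  rw [Finset.sum_comm]
  exact Finset.sum_congr rfl fun i _ => Finset.sum_congr rfl fun j _ => by ring

theorem codifferential_kahlerForm (w : TangentSpace 𝓘(ℝ, R6) p) :
    codifferential A.kahlerForm p ![w] = -∑ k, A.nablaKahler p (f.e k p) (f.e k p) w := by
  have : FiniteDimensional ℝ (TangentSpace 𝓘(ℝ, R6) p) :=
    inferInstanceAs (FiniteDimensional ℝ R6)
  have hdim : Module.finrank ℝ (TangentSpace 𝓘(ℝ, R6) p) = 6 :=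
    (finrank_euclideanSpace_fin (𝕜 := ℝ) (n := 6))
  have ho := f.orthonormal p f.mem_U
  have hspan : ⊤ ≤ Submodule.span ℝ (Set.range fun i => f.e i p) :=
    (ho.linearIndependent.span_eq_top_of_card_eq_finrank' (by simp [hdim])).ge
  let B : TangentSpace 𝓘(ℝ, R6) p →ₗ[ℝ] TangentSpace 𝓘(ℝ, R6) p →ₗ[ℝ] ℝ :=
    LinearMap.mk₂ ℝ (fun v a => A.nablaKahler p v a w)
      (fun v v' a => nablaForm_add _ v v' a w) (fun c v a => nablaForm_smul _ c v a w)
      (fun v a a' => by simp) (fun c v a => by simp)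
  have h := sum_apply_orthonormalBasis B
    (stdOrthonormalBasis ℝ (TangentSpace 𝓘(ℝ, R6) p)) (OrthonormalBasis.mk ho hspan)
  rw [OrthonormalBasis.coe_mk] at h
  rw [codifferential]
  refine congrArg Neg.neg (Eq.trans (Finset.sum_congr rfl fun a _ => ?_) h)
  exact covDerivForm_eq_nablaForm (A.mdiffTwoFormAt_kahlerForm p) _ _ _

end AdaptedFrame
end AlmostHermitianStructure
end Manifold

/-! ### Algebra of `ℝ⁶ ⊗ m`: alternation, trace, `W2` and `Θ` -/

open TensorProduct

theorem sum_smul_stdVec (u : R6) : ∑ i, u i • stdVec i = u := by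
  have := (EuclideanSpace.basisFun (Fin 6) ℝ).sum_repr u
  simpa [stdVec] using this

theorem form_two_swap (α : Form 2) (x y : R6) : α ![x, y] = -α ![y, x] := by
  have := α.map_swap ![y, x] (i := 0) (j := 1) (by simp)
  refine Eq.trans (congrArg _ ?_) this
  ext i; fin_cases i <;> rfl

theorem form_two_neg_left (α : Form 2) (x y : R6) : α ![-x, y] = -α ![x, y] := by
  have := α.toMultilinearMap.cons_smul ![y] (-1) x
  simpa using this

theorem form_two_neg_right (α : Form 2) (x y : R6) : α ![x, -y] = -α ![x, y] := by
  rw [form_two_swap, form_two_neg_left, form_two_swap α y, neg_neg]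

theorem form_three_ext {S T : Form 3} (h : ∀ u x y, S ![u, x, y] = T ![u, x, y]) : S = T := by
  ext v
  have : v = ![v 0, v 1, v 2] := by ext i; fin_cases i <;> rfl
  rw [this]
  exact h _ _ _

theorem actJ_two_apply (α : Form 2) (x y : R6) : actJ α ![x, y] = α ![stdJ x, stdJ y] := by
  refine congrArg α ?_
  ext i; fin_cases i <;> rfl

theorem actJ_three_apply (α : Form 3) (u x y : R6) :
    actJ α ![u, x, y] = α ![stdJ u, stdJ x, stdJ y] := by
  refine congrArg α ?_
  ext i; fin_cases i <;> rfl

theorem mSpace_stdJ (α : mSpace) (x y : R6) :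
    (α : Form 2) ![stdJ x, y] = (α : Form 2) ![x, stdJ y] := by
  have h : actJ (α : Form 2) = -(α : Form 2) := α.2
  have h1 := congrArg (fun β : Form 2 => β ![x, stdJ y]) h
  simp only [actJ_two_apply, stdJ_stdJ, form_two_neg_right, AlternatingMap.neg_apply] at h1
  linarith

theorem prM_apply (η : Form 2) (x y : R6) :
    (prM η : Form 2) ![x, y] = (1 / 2) * (η ![x, y] - η ![stdJ x, stdJ y]) := by
  rw [← actJ_two_apply]
  rfl

/-- The right side has the shape of the formula for `∇Ω`; this is how the projection to `m`, and
hence the intrinsic torsion, enters. -/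
theorem prM_apply_stdJ (η : Form 2) (x y : R6) :
    2 * (prM η : Form 2) ![x, stdJ y] = η ![x, stdJ y] + η ![stdJ x, y] := by
  rw [prM_apply, stdJ_stdJ, form_two_neg_right]
  ring

/-- The contraction of the first factor of `ℝ⁶ ⊗ m` with a vector. -/
def slot : R6 →ₗ[ℝ] R6 ⊗[ℝ] mSpace →ₗ[ℝ] mSpace where
  toFun u := TensorProduct.lift ((innerₗ R6 u).smulRight LinearMap.id)
  map_add' u w := by
    ext x α : 3
    simp [add_smul]
  map_smul' c u := by
    ext x α : 3
    simp [mul_smul]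

theorem slot_tmul (u x : R6) (α : mSpace) : slot u (x ⊗ₜ α) = (inner ℝ u x : ℝ) • α := by
  simp [slot]

theorem slot_sum_stdVec (u : R6) (α : Fin 6 → mSpace) :
    slot u (∑ i, stdVec i ⊗ₜ[ℝ] α i) = ∑ i, u i • α i := by
  rw [map_sum]
  refine Finset.sum_congr rfl fun i _ => ?_
  rw [slot_tmul, real_inner_comm, inner_stdVec]

/-- The trilinear components of an element of `ℝ⁶ ⊗ m`. -/
def comps (Γ : R6 ⊗[ℝ] mSpace) (u x y : R6) : ℝ := (slot u Γ : Form 2) ![x, y]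

theorem comps_add (Γ Γ' : R6 ⊗[ℝ] mSpace) (u x y : R6) :
    comps (Γ + Γ') u x y = comps Γ u x y + comps Γ' u x y := by
  simp [comps]

theorem comps_neg (Γ : R6 ⊗[ℝ] mSpace) (u x y : R6) : comps Γ (-u) x y = -comps Γ u x y := by
  rw [comps, ← neg_one_smul ℝ u, LinearMap.map_smul]
  simp [comps]

theorem comps_stdJ (Γ : R6 ⊗[ℝ] mSpace) (u x y : R6) :
    comps Γ u (stdJ x) y = comps Γ u x (stdJ y) :=
  mSpace_stdJ _ _ _

theorem comps_swap (Γ : R6 ⊗[ℝ] mSpace) (u x y : R6) : comps Γ u x y = -comps Γ u y x :=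
  form_two_swap _ _ _

theorem Phi_apply (Γ : R6 ⊗[ℝ] mSpace) (u x y : R6) :
    Phi Γ ![u, x, y] = comps Γ u x y - comps Γ x u y + comps Γ y u x := by
  induction Γ using TensorProduct.induction_on with
  | zero => simp [comps]
  | tmul z α =>
    simp [Phi, comps, slot_tmul, wedge_apply, real_inner_comm]
  | add Γ Γ' h h' =>
    rw [map_add, AlternatingMap.add_apply, h, h', comps_add, comps_add, comps_add]
    ring

theorem comps_alt_of_mem_W2 {Γ : R6 ⊗[ℝ] mSpace} (hΓ : Γ ∈ W2) (u x y : R6) :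
    comps Γ u x y - comps Γ x u y + comps Γ y u x = 0 := by
  rw [← Phi_apply, show Phi Γ = 0 from hΓ]
  rfl

/-- The 3-linear form `2 ∑ Γ(u; x, J y)` (alternating sum) determined by `Γ ∈ ℝ⁶ ⊗ m`. -/
def altJ (Γ : R6 ⊗[ℝ] mSpace) (u x y : R6) : ℝ :=
  2 * (comps Γ u x (stdJ y) - comps Γ x u (stdJ y) + comps Γ y u (stdJ x))

/-- The trace `-2 ∑ Γ(e_i; e_i, J w)` determined by `Γ ∈ ℝ⁶ ⊗ m`. -/
def traceJ (Γ : R6 ⊗[ℝ] mSpace) (w : R6) : ℝ :=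
  -2 * ∑ i, comps Γ (stdVec i) (stdVec i) (stdJ w)

theorem altJ_add (Γ Γ' : R6 ⊗[ℝ] mSpace) (u x y : R6) :
    altJ (Γ + Γ') u x y = altJ Γ u x y + altJ Γ' u x y := by
  simp only [altJ, comps_add]
  ring

theorem traceJ_add (Γ Γ' : R6 ⊗[ℝ] mSpace) (w : R6) :
    traceJ (Γ + Γ') w = traceJ Γ w + traceJ Γ' w := by
  simp only [traceJ, comps_add, Finset.sum_add_distrib]
  ring

/-- Add the vanishing alternations at `(u, x, Jy)`, `(u, Jx, y)`, `(Ju, x, y)` and `(Ju, Jx, Jy)`.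
Terms with `J` in the first slot of `Γ` cancel, and those without it add up to `altJ`. -/
theorem altJ_of_mem_W2 {Γ : R6 ⊗[ℝ] mSpace} (hΓ : Γ ∈ W2) (u x y : R6) : altJ Γ u x y = 0 := by
  have h1 := comps_alt_of_mem_W2 hΓ u x (stdJ y)
  have h2 := comps_alt_of_mem_W2 hΓ u (stdJ x) y
  have h3 := comps_alt_of_mem_W2 hΓ (stdJ u) x y
  have h4 := comps_alt_of_mem_W2 hΓ (stdJ u) (stdJ x) (stdJ y)
  simp only [comps_stdJ, stdJ_stdJ] at h1 h2 h3 h4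
  simp only [altJ, comps, form_two_neg_right] at *
  linarith

/-- Replace the basis `e_i` by `J e_i`, using that `J` permutes the basis up to sign. -/
theorem sum_comps_stdJ_stdVec (Γ : R6 ⊗[ℝ] mSpace) (w : R6) :
    ∑ i, comps Γ (stdJ (stdVec i)) (stdVec i) w
      = -∑ i, comps Γ (stdVec i) (stdVec i) (stdJ w) := by
  have hJ : stdJ (stdVec 0) = stdVec 1 ∧ stdJ (stdVec 1) = -stdVec 0 ∧
      stdJ (stdVec 2) = stdVec 3 ∧ stdJ (stdVec 3) = -stdVec 2 ∧
      stdJ (stdVec 4) = stdVec 5 ∧ stdJ (stdVec 5) = -stdVec 4 := by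
    refine ⟨?_, ?_, ?_, ?_, ?_, ?_⟩ <;> ext i <;> fin_cases i <;> simp [stdJ, stdVec]
  obtain ⟨h0, h1, h2, h3, h4, h5⟩ := hJ
  simp only [← comps_stdJ, Fin.sum_univ_six, h0, h1, h2, h3, h4, h5, comps_neg]
  simp only [comps, form_two_neg_left]
  ring

/-- Alternation at `(e_i, J e_i, w)` contains `Γ(w; e_i, J e_i)`, which is zero by skewness together
with `comps_stdJ`. The remaining two terms equate the trace with its own negative after summation.
-/
theorem traceJ_of_mem_W2 {Γ : R6 ⊗[ℝ] mSpace} (hΓ : Γ ∈ W2) (w : R6) : traceJ Γ w = 0 := by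
  have h : ∀ i, comps Γ (stdVec i) (stdVec i) (stdJ w) = comps Γ (stdJ (stdVec i)) (stdVec i) w := by
    intro i
    have h1 := comps_alt_of_mem_W2 hΓ (stdVec i) (stdJ (stdVec i)) w
    have h2 := comps_swap Γ w (stdVec i) (stdJ (stdVec i))
    rw [comps_stdJ] at h1 h2
    linarith
  have h1 := sum_comps_stdJ_stdVec Γ w
  simp_rw [← h] at h1
  rw [traceJ]
  linarith

theorem contract_two_apply (T : Form 3) (u x y : R6) : contract u T ![x, y] = T ![u, x, y] := rfl

theorem comps_Theta (T : Form 3) (u x y : R6) :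
    2 * comps (Theta T) u x (stdJ y) = T ![u, x, stdJ y] + T ![u, stdJ x, y] := by
  rw [comps, Theta, slot_sum_stdVec]
  have h : ∑ i, u i • prM (contract (stdVec i) T) = prM (contract u T) := by
    conv_rhs => rw [← sum_smul_stdVec u]
    simp [contract]
  rw [h, prM_apply_stdJ]
  rfl

/-- The derivation action of the complex structure on a 3-form. -/
def derJ (T : Form 3) (u x y : R6) : ℝ :=
  T ![stdJ u, x, y] + T ![u, stdJ x, y] + T ![u, x, stdJ y]

theorem form_three_swap_left (T : Form 3) (u x y : R6) : T ![u, x, y] = -T ![x, u, y] := by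
  have := T.map_swap ![x, u, y] (i := 0) (j := 1) (by simp)
  refine Eq.trans (congrArg _ ?_) this
  ext i; fin_cases i <;> rfl

theorem form_three_swap_right (T : Form 3) (u x y : R6) : T ![u, x, y] = -T ![u, y, x] := by
  have := T.map_swap ![u, y, x] (i := 1) (j := 2) (by simp)
  refine Eq.trans (congrArg _ ?_) this
  ext i; fin_cases i <;> rfl

/-- By `comps_Theta`, each of the three summands of `altJ` places `J` in two of the three slots of
`T`, so every slot is hit twice. -/
theorem altJ_Theta (T : Form 3) (u x y : R6) : altJ (Theta T) u x y = 2 * derJ T u x y := by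
  have h1 := comps_Theta T u x y
  have h2 := comps_Theta T x u y
  have h3 := comps_Theta T y u x
  rw [form_three_swap_left T x, form_three_swap_left T x] at h2
  rw [form_three_swap_left T y, form_three_swap_left T y, form_three_swap_right T u y,
    form_three_swap_right T _ y] at h3
  rw [altJ, derJ]
  linarith

theorem traceJ_Theta (T : Form 3) (w : R6) :
    traceJ (Theta T) w = -∑ i, T ![stdVec i, stdJ (stdVec i), w] := by
  have h : ∀ i, 2 * comps (Theta T) (stdVec i) (stdVec i) (stdJ w)
      = T ![stdVec i, stdJ (stdVec i), w] := by
    intro i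
    rw [comps_Theta]
    have := form_three_swap_left T (stdVec i) (stdVec i) (stdJ w)
    linarith
  rw [traceJ, ← Finset.sum_congr rfl fun i _ => h i, ← Finset.mul_sum]
  ring

/-! ### `dΩ` and `δΩ` as functions of the intrinsic torsion -/

section Manifold

variable {M : Type*} [TopologicalSpace M] [ChartedSpace R6 M] [IsManifold 𝓘(ℝ, R6) ∞ M]
  [RiemannianBundle (fun x : M => TangentSpace 𝓘(ℝ, R6) x)]
  [IsContMDiffRiemannianBundle 𝓘(ℝ, R6) ∞ R6 (fun x : M => TangentSpace 𝓘(ℝ, R6) x)]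

namespace AlmostHermitianStructure.AdaptedFrame

variable {A : AlmostHermitianStructure M} {p : M} (f : A.AdaptedFrame p)

theorem connectionForm_toTangent (u x y : R6) :
    f.connectionForm (f.toTangent u) ![x, y]
      = ∑ i, u i * f.connectionForm (f.e i p) ![x, y] := by
  simp only [connectionForm_apply, frameDeriv, toTangent_apply f u, map_sum, map_smul, sum_inner,
    real_inner_smul_left, Finset.smul_sum, Finset.mul_sum]
  rw [Finset.sum_comm]
  exact Finset.sum_congr rfl fun i _ => Finset.sum_congr rfl fun j _ => by ring

theorem nablaKahler_eq_comps (u x y : R6) :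
    A.nablaKahler p (f.toTangent u) (f.toTangent x) (f.toTangent y)
      = 2 * comps f.intrinsicTorsion u x (stdJ y) := by
  rw [nablaKahler_toTangent, comps, intrinsicTorsion, slot_sum_stdVec, connectionForm_toTangent,
    connectionForm_toTangent]
  simp only [Submodule.coe_sum, Submodule.coe_smul, form_sum_apply, AlternatingMap.smul_apply,
    Finset.mul_sum, smul_eq_mul, ← Finset.sum_add_distrib]
  refine Finset.sum_congr rfl fun i _ => ?_
  have := prM_apply_stdJ (f.connectionForm (f.e i p)) x y
  linear_combination (-u i) * this

theorem dOmega_apply (u x y : R6) : f.dOmega ![u, x, y] = altJ f.intrinsicTorsion u x y := by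
  have h := exteriorDerivative_apply (A.mdiffTwoFormAt_kahlerForm p) (f.toTangent u)
    (f.toTangent x) (f.toTangent y)
  have h0 : f.dOmega ![u, x, y] = exteriorDerivative A.kahlerForm p
      ![f.toTangent u, f.toTangent x, f.toTangent y] := by
    refine congrArg (exteriorDerivative A.kahlerForm p) ?_
    ext1 i; fin_cases i <;> rfl
  refine (h0.trans h).trans ?_
  have h1 := f.nablaKahler_eq_comps u x y
  have h2 := f.nablaKahler_eq_comps x u y
  have h3 := f.nablaKahler_eq_comps y u x
  rw [altJ]
  rw [AlmostHermitianStructure.nablaKahler] at h1 h2 h3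
  rw [h1, h2, h3]
  ring

theorem deltaOmega_apply (i : Fin 6) :
    f.deltaOmega i = traceJ f.intrinsicTorsion (stdVec i) := by
  have h : f.deltaOmega i = codifferential A.kahlerForm p ![f.e i p] := rfl
  rw [h, codifferential_kahlerForm, traceJ]
  have h1 : ∀ k, A.nablaKahler p (f.e k p) (f.e k p) (f.e i p)
      = 2 * comps f.intrinsicTorsion (stdVec k) (stdVec k) (stdJ (stdVec i)) := by
    intro k
    have := f.nablaKahler_eq_comps (stdVec k) (stdVec k) (stdVec i)
    rwa [toTangent_stdVec, toTangent_stdVec] at this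
  rw [Finset.sum_congr rfl fun k _ => h1 k, ← Finset.mul_sum]
  ring

end AlmostHermitianStructure.AdaptedFrame
end Manifold

/-! ### The operator `τ` and its eigenspaces -/

open TensorProduct

theorem inner_stdJ_left (x y : R6) : inner ℝ (stdJ x) y = -inner ℝ x (stdJ y) := by
  simp [stdJ, PiLp.inner_apply, Fin.sum_univ_six]
  ring

theorem stdOmega_apply (x y : R6) : stdOmega ![x, y] = inner ℝ (stdJ x) y := rfl

theorem form_three_smul_left (T : Form 3) (c : ℝ) (u x y : R6) :
    T ![c • u, x, y] = c * T ![u, x, y] :=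
  T.toMultilinearMap.cons_smul ![x, y] c u

theorem form_three_neg_fst (T : Form 3) (u x y : R6) : T ![-u, x, y] = -T ![u, x, y] := by
  have := form_three_smul_left T (-1) u x y
  simpa using this

theorem form_three_neg_snd (T : Form 3) (u x y : R6) : T ![u, -x, y] = -T ![u, x, y] := by
  rw [form_three_swap_left, form_three_neg_fst, form_three_swap_left T x]
  simp

theorem form_three_neg_trd (T : Form 3) (u x y : R6) : T ![u, x, -y] = -T ![u, x, y] := by
  rw [form_three_swap_right, form_three_neg_snd, form_three_swap_right T u y]
  simp

theorem sum_apply_stdVec (T : Form 3) (u x y : R6) : ∑ i, u i * T ![stdVec i, x, y] = T ![u, x, y] := by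
  have h : T ![∑ i, u i • stdVec i, x, y] = ∑ i, T ![u i • stdVec i, x, y] := by
    change contract _ T ![x, y] = ∑ i, contract _ T ![x, y]
    rw [← form_sum_apply]
    exact congrArg (fun S : Form 2 => S ![x, y]) (map_sum T.curryLeft _ _)
  rw [sum_smul_stdVec] at h
  rw [h]
  exact Finset.sum_congr rfl fun i _ => (form_three_smul_left T _ _ _ _).symm

theorem contract_stdOmega (x : R6) : contract x stdOmega = flat (stdJ x) := by
  ext v
  rfl

theorem tau_apply (T : Form 3) (u x y : R6) : tau T ![u, x, y] = -derJ T u x y := by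
  rw [tau, form_sum_apply]
  simp only [contract_stdOmega, wedge_apply, inner_stdJ_left, inner_stdVec]
  simp only [Finset.sum_add_distrib, Finset.sum_sub_distrib, neg_mul, Finset.sum_neg_distrib,
    contract_two_apply, Matrix.cons_val_zero, Matrix.cons_val_one, Matrix.cons_val]
  rw [sum_apply_stdVec, sum_apply_stdVec, sum_apply_stdVec, derJ, form_three_swap_left T (stdJ x),
    form_three_swap_left T (stdJ y), form_three_swap_right T u (stdJ y)]
  ring

theorem tau_tau_apply (T : Form 3) (u x y : R6) :
    tau (tau T) ![u, x, y] = -3 * T ![u, x, y]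
      + 2 * (T ![stdJ u, stdJ x, y] + T ![stdJ u, x, stdJ y] + T ![u, stdJ x, stdJ y]) := by
  simp only [tau_apply, derJ, stdJ_stdJ, form_three_neg_fst, form_three_neg_snd,
    form_three_neg_trd]
  ring

/-- Evaluating the eigenvalue equation at `(Ju, Jx, Jy)` turns the terms of `τ²` with two `J`'s into
terms with one, since `J² = -1` and the two signs cancel. -/
theorem derJ_of_tau_tau {T : Form 3} {c : ℝ} (h : tau (tau T) = c • T) (u x y : R6) :
    derJ T u x y = (c + 3) / 2 * actJ T ![u, x, y] := by
  have h1 := congrArg (fun S : Form 3 => S ![stdJ u, stdJ x, stdJ y]) h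
  simp only [tau_tau_apply, stdJ_stdJ, form_three_neg_fst, form_three_neg_snd,
    form_three_neg_trd, AlternatingMap.smul_apply, smul_eq_mul, neg_neg] at h1
  rw [actJ_three_apply, derJ]
  linarith

theorem derJ_of_mem_Lambda32 {T : Form 3} (hT : T ∈ Lambda32) (u x y : R6) :
    derJ T u x y = -3 * hodge T ![u, x, y] := by
  rw [derJ_of_tau_tau hT.1, hT.2]
  norm_num

theorem derJ_of_mem_Lambda312 {T : Form 3} (hT : T ∈ Lambda312) (u x y : R6) :
    derJ T u x y = hodge T ![u, x, y] := by
  have h : tau (tau T) = (-1 : ℝ) • T := by rw [hT.1]; ext v; simp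
  rw [derJ_of_tau_tau h, hT.2]
  norm_num

theorem derJ_wedge_stdOmega (X u x y : R6) :
    derJ (wedge (flat X) stdOmega) u x y = -wedge (flat (stdJ X)) stdOmega ![u, x, y] := by
  simp [derJ, wedge_apply, stdOmega_apply, inner_stdJ_left, stdJ_stdJ]
  ring

/-! ### The Hodge operator on basis vectors, `X ∧ Ω`, and forms with `J(T) = *T` -/

theorem vol_perm (σ : Equiv.Perm (Fin 6)) :
    vol (fun i => stdVec (σ i)) = ((Equiv.Perm.sign σ : ℤ) : ℝ) := by
  have h : vol stdVec = 1 := by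
    have := (EuclideanSpace.basisFun (Fin 6) ℝ).toBasis.det_self
    rw [vol, ← this]
    congr 1
    ext1 i
    simp [stdVec]
  have := vol.map_perm stdVec σ
  rw [h] at this
  refine Eq.trans this ?_
  rcases Int.units_eq_one_or (Equiv.Perm.sign σ) with hs | hs <;> simp [hs]

theorem hodge_apply (T : Form 3) (a b c : R6) :
    hodge T ![a, b, c] = (1 / 6) * ∑ i, ∑ j, ∑ k, T ![stdVec i, stdVec j, stdVec k] *
      vol ![stdVec i, stdVec j, stdVec k, a, b, c] := by
  simp only [hodge, AlternatingMap.smul_apply, form_sum_apply, smul_eq_mul]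
  refine congrArg _ (Finset.sum_congr rfl fun i _ => Finset.sum_congr rfl fun j _ =>
    Finset.sum_congr rfl fun k _ => congrArg _ (congrArg vol ?_))
  ext1 l; fin_cases l <;> rfl

/-- After reindexing by `σ`, only triples that permute `σ 0, σ 1, σ 2` survive in the defining sum.
These six terms are equal, as both factors change sign together, which absorbs the factor `1 / 6`.
-/
theorem hodge_perm (T : Form 3) (σ : Equiv.Perm (Fin 6)) :
    hodge T ![stdVec (σ 3), stdVec (σ 4), stdVec (σ 5)]
      = ((Equiv.Perm.sign σ : ℤ) : ℝ) * T ![stdVec (σ 0), stdVec (σ 1), stdVec (σ 2)] := by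
  set w : Fin 6 → R6 := fun i => stdVec (σ i) with hw
  set V : Fin 6 → Fin 6 → Fin 6 → ℝ := fun i j k => vol ![w i, w j, w k, w 3, w 4, w 5] with hV
  have hr : hodge T ![w 3, w 4, w 5] = (1 / 6) * ∑ i, ∑ j, ∑ k, T ![w i, w j, w k] * V i j k := by
    rw [hodge_apply]
    refine congrArg _ ((Equiv.sum_comp σ _).symm.trans (Finset.sum_congr rfl fun i _ => ?_))
    refine (Equiv.sum_comp σ _).symm.trans (Finset.sum_congr rfl fun j _ => ?_)
    exact (Equiv.sum_comp σ _).symm.trans (Finset.sum_congr rfl fun k _ => rfl)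
  have z : ∀ (v : Fin 6 → R6) (a b : Fin 6), v a = v b → a ≠ b → vol v = 0 := fun v a b h hab =>
    vol.map_eq_zero_of_eq v h hab
  have e1 : ∀ j k, V 3 j k = 0 := fun j k => z _ 0 3 rfl (by decide)
  have e2 : ∀ j k, V 4 j k = 0 := fun j k => z _ 0 4 rfl (by decide)
  have e3 : ∀ j k, V 5 j k = 0 := fun j k => z _ 0 5 rfl (by decide)
  have e4 : ∀ j k, V j 3 k = 0 := fun j k => z _ 1 3 rfl (by decide)
  have e5 : ∀ j k, V j 4 k = 0 := fun j k => z _ 1 4 rfl (by decide)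
  have e6 : ∀ j k, V j 5 k = 0 := fun j k => z _ 1 5 rfl (by decide)
  have e7 : ∀ j k, V j k 3 = 0 := fun j k => z _ 2 3 rfl (by decide)
  have e8 : ∀ j k, V j k 4 = 0 := fun j k => z _ 2 4 rfl (by decide)
  have e9 : ∀ j k, V j k 5 = 0 := fun j k => z _ 2 5 rfl (by decide)
  have d1 : ∀ j k, V j j k = 0 := fun j k => z _ 0 1 rfl (by decide)
  have d2 : ∀ j k, V j k j = 0 := fun j k => z _ 0 2 rfl (by decide)
  have d3 : ∀ j k, V j k k = 0 := fun j k => z _ 1 2 rfl (by decide)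
  have s1 : ∀ i j k, V i j k = -V j i k := fun i j k => by
    refine Eq.trans (congrArg vol ?_)
      (vol.map_swap ![w j, w i, w k, w 3, w 4, w 5] (i := 0) (j := 1) (by decide))
    ext1 i; fin_cases i <;> rfl
  have s2 : ∀ i j k, V i j k = -V i k j := fun i j k => by
    refine Eq.trans (congrArg vol ?_)
      (vol.map_swap ![w i, w k, w j, w 3, w 4, w 5] (i := 1) (j := 2) (by decide))
    ext1 i; fin_cases i <;> rfl
  have h0 : V 0 1 2 = ((Equiv.Perm.sign σ : ℤ) : ℝ) := by
    rw [← vol_perm]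
    refine congrArg vol ?_
    ext1 i; fin_cases i <;> rfl
  have t1 := form_three_swap_left T (w 1) (w 0) (w 2)
  have t2 := form_three_swap_right T (w 0) (w 2) (w 1)
  have t3 := form_three_swap_right T (w 1) (w 2) (w 0)
  have t4 := form_three_swap_left T (w 2) (w 0) (w 1)
  have t5 := form_three_swap_left T (w 2) (w 1) (w 0)
  rw [t1, neg_neg] at t3
  rw [t2, neg_neg] at t4
  rw [t3] at t5
  have v1 : V 1 0 2 = -V 0 1 2 := s1 1 0 2
  have v2 : V 0 2 1 = -V 0 1 2 := s2 0 2 1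
  have v3 : V 1 2 0 = V 0 1 2 := by rw [s2, v1, neg_neg]
  have v4 : V 2 0 1 = V 0 1 2 := by rw [s1, v2, neg_neg]
  have v5 : V 2 1 0 = -V 0 1 2 := by rw [s1, v3]
  change hodge T ![w 3, w 4, w 5] = _ * T ![w 0, w 1, w 2]
  rw [hr]
  simp only [Fin.sum_univ_six, e1, e2, e3, e4, e5, e6, e7, e8, e9, d1, d2, d3, mul_zero, add_zero,
    zero_add, v1, v2, v3, v4, v5]
  rw [← h0, t1, t2, t3, t4, t5]
  ring

/-- The components of the standard Kähler form. -/
def omegaInt (i j : Fin 6) : ℤ :=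
  ![![0, 1, 0, 0, 0, 0], ![-1, 0, 0, 0, 0, 0], ![0, 0, 0, 1, 0, 0], ![0, 0, -1, 0, 0, 0],
    ![0, 0, 0, 0, 0, 1], ![0, 0, 0, 0, -1, 0]] i j

theorem stdJ_stdVec_apply (i j : Fin 6) : stdJ (stdVec i) j = (omegaInt i j : ℝ) := by
  fin_cases i <;> fin_cases j <;> simp [stdJ, stdVec, omegaInt]

theorem stdOmega_stdVec (i j : Fin 6) : stdOmega ![stdVec i, stdVec j] = (omegaInt i j : ℝ) := by
  rw [stdOmega_apply, real_inner_comm, inner_stdVec, stdJ_stdVec_apply]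

/-- The identity `*(e_m ∧ Ω) = J e_m ∧ Ω` in components, over the integers so that a finite check
over all permutations decides it. -/
theorem hodge_omegaInt : ∀ σ : Equiv.Perm (Fin 6), ∀ m : Fin 6,
    (Equiv.Perm.sign σ : ℤ) * ((if m = σ 0 then omegaInt (σ 1) (σ 2) else 0)
        - (if m = σ 1 then omegaInt (σ 0) (σ 2) else 0)
        + (if m = σ 2 then omegaInt (σ 0) (σ 1) else 0))
      = omegaInt m (σ 3) * omegaInt (σ 4) (σ 5) - omegaInt m (σ 4) * omegaInt (σ 3) (σ 5)
        + omegaInt m (σ 5) * omegaInt (σ 3) (σ 4) := by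
  decide +kernel

theorem hodge_wedge_stdVec_perm (m : Fin 6) (σ : Equiv.Perm (Fin 6)) :
    hodge (wedge (flat (stdVec m)) stdOmega) ![stdVec (σ 3), stdVec (σ 4), stdVec (σ 5)]
      = wedge (flat (stdJ (stdVec m))) stdOmega ![stdVec (σ 3), stdVec (σ 4), stdVec (σ 5)] := by
  have h := congrArg (fun z : ℤ => (z : ℝ)) (hodge_omegaInt σ m)
  have hm : ∀ i j, (stdVec i) j = if i = j then (1 : ℝ) else 0 := fun i j => by
    simp [stdVec, eq_comm]
  have hr : ∀ (x : R6) (i : Fin 6), (inner ℝ x (stdVec i) : ℝ) = x i := fun x i => by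
    rw [real_inner_comm, inner_stdVec]
  rw [hodge_perm, wedge_apply, wedge_apply]
  simp only [Matrix.cons_val_zero, Matrix.cons_val_one, Matrix.cons_val, stdOmega_stdVec,
    hr, stdJ_stdVec_apply, hm]
  push_cast at h
  simp only [← h, ite_mul, one_mul, zero_mul]

/-- The symmetric group is 3-transitive. An alternating 3-form is determined by injective index
triples, so the permutation formulas suffice. -/
theorem exists_perm_extending {s : Fin 3 → Fin 6} (hs : Function.Injective s) :
    ∃ σ : Equiv.Perm (Fin 6), σ 3 = s 0 ∧ σ 4 = s 1 ∧ σ 5 = s 2 := by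
  have h := Equiv.Perm.isMultiplyPretransitive (Fin 6) 3
  have hi : Function.Injective (![3, 4, 5] : Fin 3 → Fin 6) := by decide
  obtain ⟨σ, hσ⟩ := h.exists_smul_eq (⟨_, hi⟩ : Fin 3 ↪ Fin 6) ⟨s, hs⟩
  exact ⟨σ, DFunLike.congr_fun hσ 0, DFunLike.congr_fun hσ 1, DFunLike.congr_fun hσ 2⟩

theorem hodge_wedge_stdVec (m : Fin 6) :
    hodge (wedge (flat (stdVec m)) stdOmega) = wedge (flat (stdJ (stdVec m))) stdOmega := by
  refine (EuclideanSpace.basisFun (Fin 6) ℝ).toBasis.ext_alternating fun s hs => ?_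
  obtain ⟨σ, h0, h1, h2⟩ := exists_perm_extending hs
  have h := hodge_wedge_stdVec_perm m σ
  rw [h0, h1, h2] at h
  have hv : (fun i => (EuclideanSpace.basisFun (Fin 6) ℝ).toBasis (s i))
      = ![stdVec (s 0), stdVec (s 1), stdVec (s 2)] := by
    ext1 i; fin_cases i <;> simp [stdVec]
  rw [hv]
  exact h

theorem wedge_flat_add (x y : R6) (α : Form 2) :
    wedge (flat (x + y)) α = wedge (flat x) α + wedge (flat y) α := by
  ext v
  simp [wedge_apply, inner_add_left]
  ring

theorem wedge_flat_smul (c : ℝ) (x : R6) (α : Form 2) :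
    wedge (flat (c • x)) α = c • wedge (flat x) α := by
  ext v
  simp [wedge_apply, real_inner_smul_left]
  ring

theorem hodge_add (S T : Form 3) : hodge (S + T) = hodge S + hodge T := by
  simp only [hodge, AlternatingMap.add_apply, add_smul, Finset.sum_add_distrib, smul_add]

theorem hodge_smul (c : ℝ) (T : Form 3) : hodge (c • T) = c • hodge T := by
  simp only [hodge, AlternatingMap.smul_apply, smul_assoc, ← Finset.smul_sum]
  rw [smul_comm]

theorem hodge_wedge_stdOmega (X : R6) :
    hodge (wedge (flat X) stdOmega) = wedge (flat (stdJ X)) stdOmega := by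
  let L : R6 →ₗ[ℝ] Form 3 :=
    { toFun := fun x => hodge (wedge (flat x) stdOmega)
      map_add' := fun x y => by rw [wedge_flat_add, hodge_add]
      map_smul' := fun c x => by rw [wedge_flat_smul, hodge_smul]; rfl }
  let L' : R6 →ₗ[ℝ] Form 3 :=
    { toFun := fun x => wedge (flat (stdJ x)) stdOmega
      map_add' := fun x y => by rw [map_add, wedge_flat_add]
      map_smul' := fun c x => by rw [map_smul, wedge_flat_smul]; rfl }
  have h : L = L' := by
    refine (EuclideanSpace.basisFun (Fin 6) ℝ).toBasis.ext fun i => ?_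
    have : (EuclideanSpace.basisFun (Fin 6) ℝ).toBasis i = stdVec i := by simp [stdVec]
    rw [this]
    exact hodge_wedge_stdVec i
  exact LinearMap.congr_fun h X

theorem stdJ_stdVec : stdJ (stdVec 0) = stdVec 1 ∧ stdJ (stdVec 1) = -stdVec 0 ∧
    stdJ (stdVec 2) = stdVec 3 ∧ stdJ (stdVec 3) = -stdVec 2 ∧
    stdJ (stdVec 4) = stdVec 5 ∧ stdJ (stdVec 5) = -stdVec 4 := by
  refine ⟨?_, ?_, ?_, ?_, ?_, ?_⟩ <;> ext i <;> fin_cases i <;> simp [stdJ, stdVec]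

/-- The sum is twice the contraction of `T` with `Ω`. For `e_m` in one `J`-invariant coordinate
plane, `J(T) = *T` gives opposite values to `T` on `e_m` with the two other planes, and the plane of
`e_m` itself contributes zero. -/
theorem sum_stdJ_of_actJ_eq_hodge {T : Form 3} (hT : actJ T = hodge T) (m : Fin 6) :
    ∑ i, T ![stdVec i, stdJ (stdVec i), stdVec m] = 0 := by
  have h : ∀ σ : Equiv.Perm (Fin 6),
      T ![stdJ (stdVec (σ 3)), stdJ (stdVec (σ 4)), stdJ (stdVec (σ 5))]
        = ((Equiv.Perm.sign σ : ℤ) : ℝ) * T ![stdVec (σ 0), stdVec (σ 1), stdVec (σ 2)] := by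
    intro σ
    rw [← hodge_perm, ← hT, actJ_three_apply]
  have hs : ∀ (s t : Fin 6 → Fin 6) (h1 : Function.LeftInverse t s)
      (h2 : Function.RightInverse t s) (c : ℤ), (Equiv.Perm.sign ⟨s, t, h1, h2⟩ : ℤ) = c →
      T ![stdJ (stdVec (s 3)), stdJ (stdVec (s 4)), stdJ (stdVec (s 5))]
        = (c : ℝ) * T ![stdVec (s 0), stdVec (s 1), stdVec (s 2)] := by
    intro s t h1 h2 c hc
    rw [← hc]
    exact h ⟨s, t, h1, h2⟩
  -- One permutation for each `m`: the first three entries are `m` and one of the other planes, the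
  -- last three are the `J`-partner of `m` and the remaining plane. The second list is the inverse
  -- permutation, followed by the sign.
  have h0 := hs ![0, 4, 5, 1, 2, 3] ![0, 3, 4, 5, 1, 2] (by decide) (by decide) 1 (by decide)
  have h1 := hs ![1, 4, 5, 0, 2, 3] ![3, 0, 4, 5, 1, 2] (by decide) (by decide) (-1) (by decide)
  have h2 := hs ![2, 4, 5, 3, 0, 1] ![4, 5, 0, 3, 1, 2] (by decide) (by decide) 1 (by decide)
  have h3 := hs ![3, 4, 5, 2, 0, 1] ![4, 5, 3, 0, 1, 2] (by decide) (by decide) (-1) (by decide)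
  have h4 := hs ![4, 2, 3, 5, 0, 1] ![4, 5, 1, 2, 0, 3] (by decide) (by decide) 1 (by decide)
  have h5 := hs ![5, 2, 3, 4, 0, 1] ![4, 5, 1, 2, 3, 0] (by decide) (by decide) (-1) (by decide)
  obtain ⟨j0, j1, j2, j3, j4, j5⟩ := stdJ_stdVec
  simp only [Matrix.cons_val, j0, j1, j2, j3, j4, j5, form_three_neg_fst,
    form_three_neg_trd, Int.cast_one, Int.cast_neg] at h0 h1 h2 h3 h4 h5
  have rot : ∀ u x y, T ![u, x, y] = T ![y, u, x] := fun u x y => by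
    rw [form_three_swap_right, form_three_swap_left, neg_neg]
  have z : ∀ x y, T ![x, x, y] = 0 := fun x y => by
    have := form_three_swap_left T x x y
    linarith
  have sw : ∀ u x y, T ![u, x, y] = -T ![u, y, x] := form_three_swap_right T
  have z' : ∀ x y, T ![x, y, x] = 0 := fun x y => by rw [rot, z]
  have key : ∀ m, T ![stdVec m, stdVec 0, stdVec 1] + T ![stdVec m, stdVec 2, stdVec 3]
      + T ![stdVec m, stdVec 4, stdVec 5] = 0 := by
    have g0 : T ![stdVec 0, stdVec 0, stdVec 1] + T ![stdVec 0, stdVec 2, stdVec 3]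
      + T ![stdVec 0, stdVec 4, stdVec 5] = 0 := by
      rw [z, sw _ (stdVec 2)]
      linarith
    have g1 : T ![stdVec 1, stdVec 0, stdVec 1] + T ![stdVec 1, stdVec 2, stdVec 3]
      + T ![stdVec 1, stdVec 4, stdVec 5] = 0 := by
      rw [z', sw _ (stdVec 2)]
      linarith
    have g2 : T ![stdVec 2, stdVec 0, stdVec 1] + T ![stdVec 2, stdVec 2, stdVec 3]
      + T ![stdVec 2, stdVec 4, stdVec 5] = 0 := by
      rw [z, sw _ (stdVec 0)]
      linarith
    have g3 : T ![stdVec 3, stdVec 0, stdVec 1] + T ![stdVec 3, stdVec 2, stdVec 3]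
      + T ![stdVec 3, stdVec 4, stdVec 5] = 0 := by
      rw [z', sw _ (stdVec 0)]
      linarith
    have g4 : T ![stdVec 4, stdVec 0, stdVec 1] + T ![stdVec 4, stdVec 2, stdVec 3]
      + T ![stdVec 4, stdVec 4, stdVec 5] = 0 := by
      rw [z, sw _ (stdVec 0)]
      linarith
    have g5 : T ![stdVec 5, stdVec 0, stdVec 1] + T ![stdVec 5, stdVec 2, stdVec 3]
      + T ![stdVec 5, stdVec 4, stdVec 5] = 0 := by
      rw [z', sw _ (stdVec 0)]
      linarith
    intro m
    fin_cases m
    exacts [g0, g1, g2, g3, g4, g5]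
  have hm := key m
  rw [← rot (stdVec 0), ← rot (stdVec 2), ← rot (stdVec 4)] at hm
  simp only [Fin.sum_univ_six, j0, j1, j2, j3, j4, j5, form_three_neg_snd]
  rw [form_three_swap_left T (stdVec 1), form_three_swap_left T (stdVec 3),
    form_three_swap_left T (stdVec 5)]
  linarith

/-- Summing `(X ∧ Ω)(e_i, J e_i, e_m)` over `i`, the term with `Ω(e_i, J e_i) = 1` gives `6 X m` and
each of the other two gives `-X m`, hence `4 X m` in total. -/
theorem traceJ_Theta_wedge_stdOmega (X : R6) (m : Fin 6) :
    traceJ (Theta (wedge (flat X) stdOmega)) (stdVec m) = -4 * X m := by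
  obtain ⟨j0, j1, j2, j3, j4, j5⟩ := stdJ_stdVec
  have hr : ∀ (x : R6) (i : Fin 6), (inner ℝ x (stdVec i) : ℝ) = x i := fun x i => by
    rw [real_inner_comm, inner_stdVec]
  rw [traceJ_Theta]
  simp only [Fin.sum_univ_six, wedge_apply, Matrix.cons_val_zero, Matrix.cons_val_one,
    Matrix.cons_val, j0, j1, j2, j3, j4, j5, stdOmega_apply, hr, inner_neg_right,
    map_neg]
  fin_cases m <;> simp [stdVec] <;> ring

/-! ### The explicit formulas for `δΩ` and `dΩ` -/

section Manifold

variable {M : Type*} [TopologicalSpace M] [ChartedSpace R6 M] [IsManifold 𝓘(ℝ, R6) ∞ M]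
  [RiemannianBundle (fun x : M => TangentSpace 𝓘(ℝ, R6) x)]
  [IsContMDiffRiemannianBundle 𝓘(ℝ, R6) ∞ R6 (fun x : M => TangentSpace 𝓘(ℝ, R6) x)]

namespace AlmostHermitianStructure.AdaptedFrame

variable {A : AlmostHermitianStructure M} {p : M} (f : A.AdaptedFrame p)

theorem deltaOmega_of_intrinsicTorsion_eq {T₂ T₁₂ : Form 3} {X : R6} {Γ₁₆ : R6 ⊗[ℝ] mSpace}
    (h₂ : T₂ ∈ Lambda32) (h₁₂ : T₁₂ ∈ Lambda312) (h₁₆ : Γ₁₆ ∈ W2)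
    (hΓ : f.intrinsicTorsion = Theta T₂ + Theta (wedge (flat X) stdOmega) + Theta T₁₂ + Γ₁₆) :
    f.deltaOmega = (-4 : ℝ) • X := by
  ext i
  rw [deltaOmega_apply, hΓ, traceJ_add, traceJ_add, traceJ_add, traceJ_of_mem_W2 h₁₆,
    traceJ_Theta_wedge_stdOmega, traceJ_Theta, traceJ_Theta, sum_stdJ_of_actJ_eq_hodge h₂.2,
    sum_stdJ_of_actJ_eq_hodge h₁₂.2]
  simp

theorem dOmega_of_intrinsicTorsion_eq {T₂ T₁₂ : Form 3} {X : R6} {Γ₁₆ : R6 ⊗[ℝ] mSpace}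
    (h₂ : T₂ ∈ Lambda32) (h₁₂ : T₁₂ ∈ Lambda312) (h₁₆ : Γ₁₆ ∈ W2)
    (hΓ : f.intrinsicTorsion = Theta T₂ + Theta (wedge (flat X) stdOmega) + Theta T₁₂ + Γ₁₆) :
    f.dOmega = (-6 : ℝ) • hodge T₂ - (2 : ℝ) • hodge (wedge (flat X) stdOmega)
      + (2 : ℝ) • hodge T₁₂ := by
  refine form_three_ext fun u x y => ?_
  rw [dOmega_apply, hΓ, altJ_add, altJ_add, altJ_add, altJ_of_mem_W2 h₁₆, altJ_Theta, altJ_Theta,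
    altJ_Theta, derJ_of_mem_Lambda32 h₂, derJ_of_mem_Lambda312 h₁₂, derJ_wedge_stdOmega,
    ← hodge_wedge_stdOmega]
  simp only [AlternatingMap.add_apply, AlternatingMap.sub_apply, AlternatingMap.smul_apply,
    smul_eq_mul]
  ring

end AlmostHermitianStructure.AdaptedFrame
end Manifold

end AlmostHermitian

end

theorem mainTheorem7
    {M : Type*} [TopologicalSpace M] [ChartedSpace R6 M] [IsManifold 𝓘(ℝ, R6) ∞ M]
    [RiemannianBundle (fun x : M => TangentSpace 𝓘(ℝ, R6) x)]
    [IsContMDiffRiemannianBundle 𝓘(ℝ, R6) ∞ R6 (fun x : M => TangentSpace 𝓘(ℝ, R6) x)]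
    (A : AlmostHermitianStructure M)
    {M' : Type*} [TopologicalSpace M'] [ChartedSpace R6 M'] [IsManifold 𝓘(ℝ, R6) ∞ M']
    [RiemannianBundle (fun x : M' => TangentSpace 𝓘(ℝ, R6) x)]
    [IsContMDiffRiemannianBundle 𝓘(ℝ, R6) ∞ R6 (fun x : M' => TangentSpace 𝓘(ℝ, R6) x)]
    (A' : AlmostHermitianStructure M') :
    -- `dΩ` and `δΩ` do not depend on the `𝒲₂`-component of the intrinsic torsion
    (∀ (p : M) (f : A.AdaptedFrame p) (p' : M') (f' : A'.AdaptedFrame p'),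
      f.intrinsicTorsion - f'.intrinsicTorsion ∈ W2 →
        f.deltaOmega = f'.deltaOmega ∧ f.dOmega = f'.dOmega) ∧
    -- the explicit formulas
    (∀ (p : M) (f : A.AdaptedFrame p) (T₂ T₁₂ : Form 3) (X : R6)
      (Γ₁₆ : TensorProduct ℝ R6 mSpace),
      T₂ ∈ Lambda32 → T₁₂ ∈ Lambda312 → Γ₁₆ ∈ W2 →
      f.intrinsicTorsion = Theta T₂ + Theta (wedge (flat X) stdOmega) + Theta T₁₂ + Γ₁₆ →
        f.deltaOmega = (-4 : ℝ) • X ∧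
        f.dOmega = (-6 : ℝ) • hodge T₂ - (2 : ℝ) • hodge (wedge (flat X) stdOmega)
          + (2 : ℝ) • hodge T₁₂) := by
  refine ⟨fun p f p' f' h => ?_, fun p f T₂ T₁₂ X Γ₁₆ h₂ h₁₂ h₁₆ hΓ =>
    ⟨f.deltaOmega_of_intrinsicTorsion_eq h₂ h₁₂ h₁₆ hΓ,
      f.dOmega_of_intrinsicTorsion_eq h₂ h₁₂ h₁₆ hΓ⟩⟩
  -- Additivity of `traceJ` and `altJ` isolates the difference of the torsions, on which both
  -- vanish.
  have hΓ : f.intrinsicTorsion = (f.intrinsicTorsion - f'.intrinsicTorsion) + f'.intrinsicTorsion :=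
    (sub_add_cancel _ _).symm
  constructor
  · ext i
    rw [f.deltaOmega_apply, f'.deltaOmega_apply, hΓ, traceJ_add, traceJ_of_mem_W2 h, zero_add]
  · refine form_three_ext fun u x y => ?_
    rw [f.dOmega_apply, f'.dOmega_apply, hΓ, altJ_add, altJ_of_mem_W2 h, zero_add]
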